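/- Let $\Lambda$ be a finite set of $N$ sites, each carrying a copy of $\mathbb C^d$, which are the vertices of a graph (for example a regular $D$-dimensional lattice with its nearest-neighbour bonds). For $A\subseteq\Lambda$ let $|\partial A|$ be the number of bonds joining $A$ to $\bar A=\Lambda\setminus A$. Let $H=\sum_{x\in\Lambda}h_x$, where each $h_x$ is Hermitian, acts non-trivially on a set of at most $b$ sites, and satisfies $\|h_x\|\le h$. Let $\mathcal B(A)$ be the set of terms $h_x$ acting on both $A$ and $\bar A$. For a positive integer $m$, call $A$ *$m$-regular* if there are non-empty sets $A_{-m}\subseteq\dots\subseteq A_{-1}\subseteq A_0=A\subseteq A_1\subseteq\dots\subseteq A_m$ of sites such that $|A_m\setminus A|\le 10m|\partial A|$, $|A\setminus A_{-m}|\le 10m|\partial A|$, and every term $h_x$ belongs to at most one of the sets $\mathcal B(A_q)$, $-m\le q\le m$. Let $|\Psi\rangle$ be a unit vector and $\chi>0$ such that for every region $B\subseteq\Lambda$ the reduced density matrix of $|\Psi\rangle$ on $B$ has rank at most $\chi^{|\partial B|}$, and suppose that the energy standard deviation $\sqrt{\langle\Psi|H^2|\Psi\rangle-\langle\Psi|H|\Psi\rangle^2}$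 is positive (that is, $|\Psi\rangle$ is not an eigenstate of $H$). Let $F(t)=|\langle\Psi|e^{-\mathrm iHt}|\Psi\rangle|$ and suppose that the revival at some time $\tau>0$ is perfect, $F(\tau)=F(0)$. Let $\{|E_j\rangle\}$ be an orthonormal basis of eigenvectors of $H$, chosen within the energy eigenspaces so that every energy appears at most once in the decomposition $|\Psi\rangle=\sum_jc_j|E_j\rangle$. Let $A$ be a region with $|\partial A|\geq 1$ which is $m$-regular for a positive integer $m$ obtained by rounding $\sqrt{hN\tau/(\pi|\partial A|)}$ up or down, that is, $\bigl|m-\sqrt{hN\tau/(\pi|\partial A|)}\bigr|<1$. Then for every $i$ with $c_i\neq0$ the Rényi-$0$ entropy (the logarithm of the rank) of the reduced state of $|E_i\rangle$ on $A$ satisfies $$S_0\bigl(\mathrm{Tr}_{\bar A}|E_i\rangle\langle E_i|\bigr)\le 7\sqrt{hN\tau|\partial A|}\,\log\bigl(hN^2\tau d^b\bigr)+|\partial A|\log\chi .$$ -/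

import Mathlib

noncomputable section

namespace SpinLattice

/-- Classical spin configurations: they label the product basis of `N = |Λ|` sites, each of local
dimension `d`. -/
abbrev Config (Λ : Type*) (d : ℕ) := Λ → Fin d

/-- The Hilbert space of the system, isomorphic to the tensor product of the `ℂ ^ d` over the
sites. -/
abbrev State (Λ : Type*) (d : ℕ) := EuclideanSpace ℂ (Config Λ d)

/-- Operators on the Hilbert space, as matrices in the product basis. -/
abbrev Op (Λ : Type*) (d : ℕ) := Matrix (Config Λ d) (Config Λ d) ℂ

variable {Λ : Type*} [Fintype Λ] [DecidableEq Λ] {d : ℕ}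

/-- The action of an operator on the Hilbert space; its norm is the usual operator norm. -/
def Op.act (M : Op Λ d) : State Λ d →L[ℂ] State Λ d :=
  Matrix.toEuclideanCLM (n := Config Λ d) (𝕜 := ℂ) M

/-- The expectation value `⟨ψ| M |ψ⟩`. -/
def expect (M : Op Λ d) (ψ : State Λ d) : ℂ := inner ℂ ψ (M.act ψ)

/-- `M` acts only on the sites of `S`: it is of the form `M_S ⊗ 1`, where `1` is the identity on
the sites outside `S`. -/
def IsSupportedOn (S : Finset Λ) (M : Op Λ d) : Prop :=
  ∃ K : Matrix (S → Fin d) (S → Fin d) ℂ, ∀ s t : Config Λ d,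
    M s t = if ∀ x, x ∉ S → s x = t x then K (fun x => s x) (fun x => t x) else 0

/-- A local Hamiltonian: one Hermitian term `h_x` for each site `x`, acting on at most `b` sites
(the set `supp x`), of operator norm at most `h`. -/
structure LocalHamiltonian (Λ : Type*) [Fintype Λ] [DecidableEq Λ] (d b : ℕ) (h : ℝ) where
  term : Λ → Op Λ d
  supp : Λ → Finset Λ
  isHermitian : ∀ x, (term x).IsHermitian
  isSupportedOn : ∀ x, IsSupportedOn (supp x) (term x)
  card_supp_le : ∀ x, (supp x).card ≤ b
  norm_le : ∀ x, ‖(term x).act‖ ≤ h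

/-- The total Hamiltonian `H = ∑ x, h_x`. -/
def LocalHamiltonian.total {b : ℕ} {h : ℝ} (H : LocalHamiltonian Λ d b h) : Op Λ d :=
  ∑ x, H.term x

/-- The time evolution `exp (- i t H)`. -/
def timeEvolution (H : Op Λ d) (t : ℝ) : Op Λ d :=
  NormedSpace.exp ((-(Complex.I * (t : ℂ))) • H)

/-- The fidelity `F(t) = |⟨ψ| exp (- i t H) |ψ⟩|` with the initial state. -/
def fidelity (H : Op Λ d) (ψ : State Λ d) (t : ℝ) : ℝ := ‖expect (timeEvolution H t) ψ‖

/-- The standard deviation of the energy, `√(⟨H²⟩ - ⟨H⟩²)`. -/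
def energyStdDev (H : Op Λ d) (ψ : State Λ d) : ℝ :=
  Real.sqrt ((expect (H * H) ψ).re - (expect H ψ).re ^ 2)

/-- The configuration that agrees with `s` on `A` and with `u` off `A`. -/
def glue (A : Finset Λ) (s : {x // x ∈ A} → Fin d) (u : {x // x ∉ A} → Fin d) : Config Λ d :=
  fun x => if hx : x ∈ A then s ⟨x, hx⟩ else u ⟨x, hx⟩

/-- The reduced density matrix on `A` of the pure state `ψ`: the partial trace of `|ψ⟩⟨ψ|` over the
sites outside `A`. -/
def reducedDensity (A : Finset Λ) (ψ : State Λ d) :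
    Matrix ({x // x ∈ A} → Fin d) ({x // x ∈ A} → Fin d) ℂ :=
  fun s t => ∑ u : {x // x ∉ A} → Fin d, ψ (glue A s u) * star (ψ (glue A t u))

/-- The Rényi-0 entropy of a density matrix: `log Tr ρ^0`, where `ρ^0` is the projection onto the
range of `ρ`, that is, the logarithm of the rank. -/
def renyiZero {ι : Type*} [Fintype ι] (ρ : Matrix ι ι ℂ) : ℝ := Real.log (ρ.rank : ℝ)

/-- The area `|∂A|` of the boundary of a region: the number of lattice bonds that join a site in
`A` to a site outside `A`. -/
def boundaryArea (G : SimpleGraph Λ) [DecidableRel G.Adj] (A : Finset Λ) : ℕ :=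
  (G.interedges A Aᶜ).card

/-- A low-entangled state: the reduced density matrix of every region `B` has rank at most
`χ ^ |∂B|`. -/
def IsLowEntangled (G : SimpleGraph Λ) [DecidableRel G.Adj] (χ : ℝ) (ψ : State Λ d) : Prop :=
  ∀ B : Finset Λ, ((reducedDensity B ψ).rank : ℝ) ≤ χ ^ boundaryArea G B

/-- `𝓑(A)`: the (labels of the) local terms that act both on `A` and on its complement. -/
def LocalHamiltonian.crossing {b : ℕ} {h : ℝ} (H : LocalHamiltonian Λ d b h) (A : Finset Λ) :
    Finset Λ :=
  Finset.univ.filter fun x => (H.supp x ∩ A).Nonempty ∧ (H.supp x \ A).Nonempty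

/-- The bipartition of the lattice into `A` and its complement is `m`-regular. The sets are
`R q` for `-m ≤ q ≤ m`; other values of `q` play no role. -/
def LocalHamiltonian.IsRegular {b : ℕ} {h : ℝ} (H : LocalHamiltonian Λ d b h)
    (G : SimpleGraph Λ) [DecidableRel G.Adj] (m : ℕ) (A : Finset Λ) : Prop :=
  ∃ R : ℤ → Finset Λ,
    R 0 = A ∧
    (∀ q ∈ Set.Icc (-(m : ℤ)) m, (R q).Nonempty) ∧
    (∀ q ∈ Set.Ico (-(m : ℤ)) m, R q ⊆ R (q + 1)) ∧
    (R m \ A).card ≤ 10 * m * boundaryArea G A ∧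
    (A \ R (-(m : ℤ))).card ≤ 10 * m * boundaryArea G A ∧
    ∀ x : Λ, ∀ q ∈ Set.Icc (-(m : ℤ)) m, ∀ q' ∈ Set.Icc (-(m : ℤ)) m,
      x ∈ H.crossing (R q) → x ∈ H.crossing (R q') → q = q'

/-- `e` is an orthonormal basis of eigenvectors of `H` with energies `E`, chosen within the energy
eigenspaces in such a way that every energy appears at most once in the decomposition
`ψ = ∑ i, ⟪e i, ψ⟫ • e i`. -/
structure IsAdaptedEigenbasis {ι : Type*} [Fintype ι] (H : Op Λ d) (ψ : State Λ d)
    (e : OrthonormalBasis ι ℂ (State Λ d)) (E : ι → ℝ) : Prop where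
  eigen : ∀ i, H.act (e i) = (E i : ℂ) • e i
  unique : ∀ i j, inner ℂ (e i) ψ ≠ 0 → inner ℂ (e j) ψ ≠ 0 → E i = E j → i = j

end SpinLattice

end

noncomputable section

set_option linter.unusedSectionVars false

/-! A perfect revival is equality in Cauchy–Schwarz, so the evolved state is a multiple of `Ψ` and
the occupied energies differ by multiples of `2π/τ`. They lie in `[-hN, hN]`, so there are `l + 1`
of them with `l ≤ hNτ/π`. Interpolation at these energies yields each occupied eigenvector, up to a
nonzero scalar, as a polynomial of degree at most `l` in `H` applied to `Ψ`
(`exists_polynomial_act_eq_smul`). It remains to bound how much such a polynomial raises the Schmidt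
rank across `A`.

Expanding across `A` alone would allow up to `l` crossing terms in a product, giving an exponent
linear in `l`. Instead, `2m + 1` nested cuts near `A` are used, and each local term is marked by the
variable of the cut it crosses. A monomial of degree at most `l` has exponent at most `t = l / (2m +
1)` in some variable. Across that cut its coefficient is a sum of few product operators, since at
most `t` crossing terms occur (`map_coeff_aeval_mem_productSpan`). Passing from `A` to the cut and
back costs powers of `d` (`schmidtRank_aeval_total_le`). The logarithm of the rank thus grows by
about `l / m` plus `m |∂A|`, up to logarithms, and the prescribed `m` balances the two. -/

namespace SpinLattice

/-! ### Rank of sums of matrices. -/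

section MatrixRank

variable {m n : Type*} [Fintype n]

theorem rank_add_le_rank_add_rank (M N : Matrix m n ℂ) : (M + N).rank ≤ M.rank + N.rank := by
  have hle : LinearMap.range (M + N).mulVecLin ≤
      LinearMap.range M.mulVecLin ⊔ LinearMap.range N.mulVecLin := by
    rintro _ ⟨v, rfl⟩
    rw [Matrix.mulVecLin_add]
    exact Submodule.add_mem_sup ⟨v, rfl⟩ ⟨v, rfl⟩
  exact (Submodule.finrank_mono hle).trans (Submodule.finrank_add_le_finrank_add_finrank _ _)

theorem rank_sum_le_card_mul {κ : Type*} (s : Finset κ) (M : κ → Matrix m n ℂ) (k : ℕ)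
    (hM : ∀ i ∈ s, (M i).rank ≤ k) : (∑ i ∈ s, M i).rank ≤ s.card * k := by
  classical
  induction s using Finset.induction_on with
  | empty => simp
  | insert i s hi ih =>
    rw [Finset.sum_insert hi, Finset.card_insert_of_notMem hi, add_mul, one_mul, add_comm]
    exact (rank_add_le_rank_add_rank _ _).trans
      (add_le_add (ih fun j hj => hM j (by simp [hj])) (hM i (by simp)))

end MatrixRank

/-! ### Schmidt rank across a cut. -/

variable {Λ : Type*} [Fintype Λ] [DecidableEq Λ] {d : ℕ}

/-- The amplitudes of a state, as a matrix with rows labelled by the configurations of `A` and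
columns by those of the complement. -/
def amplitudes (A : Finset Λ) (ψ : State Λ d) :
    Matrix ({x // x ∈ A} → Fin d) ({x // x ∉ A} → Fin d) ℂ :=
  fun s u => ψ (glue A s u)

/-- The number of terms of the Schmidt decomposition of `ψ` between `A` and its complement. -/
def schmidtRank (A : Finset Λ) (ψ : State Λ d) : ℕ := (amplitudes A ψ).rank

omit [Fintype Λ] in
theorem glue_restrict (A : Finset Λ) (s : Config Λ d) :
    glue A (fun x => s x) (fun x => s x) = s := by
  funext x
  simp [glue]

-- The reduced density matrix is `M * Mᴴ` for the amplitude matrix `M`.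
open scoped ComplexOrder in
theorem rank_reducedDensity (A : Finset Λ) (ψ : State Λ d) :
    (reducedDensity A ψ).rank = schmidtRank A ψ := by
  rw [schmidtRank, ← Matrix.rank_self_mul_conjTranspose (amplitudes A ψ)]
  rfl

theorem schmidtRank_pos (A : Finset Λ) {ψ : State Λ d} (hψ : ψ ≠ 0) : 0 < schmidtRank A ψ := by
  rw [Nat.pos_iff_ne_zero]
  intro h0
  apply hψ
  have hM : amplitudes A ψ = 0 := by
    have hr : LinearMap.range (amplitudes A ψ).mulVecLin = ⊥ := Submodule.finrank_eq_zero.mp h0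
    rw [LinearMap.range_eq_bot] at hr
    exact Matrix.toLin'.injective (by simpa [Matrix.toLin'_apply'] using hr)
  ext s
  rw [← glue_restrict A s]
  exact congrFun (congrFun hM _) _

theorem schmidtRank_sum_le {κ : Type*} (A : Finset Λ) (s : Finset κ) (ψ : κ → State Λ d) (k : ℕ)
    (hψ : ∀ i ∈ s, schmidtRank A (ψ i) ≤ k) : schmidtRank A (∑ i ∈ s, ψ i) ≤ s.card * k := by
  have : amplitudes A (∑ i ∈ s, ψ i) = ∑ i ∈ s, amplitudes A (ψ i) := by
    ext u v
    simp [amplitudes, Matrix.sum_apply]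
  rw [schmidtRank, this]
  exact rank_sum_le_card_mul s _ k hψ

theorem schmidtRank_smul (A : Finset Λ) {c : ℂ} (hc : c ≠ 0) (ψ : State Λ d) :
    schmidtRank A (c • ψ) = schmidtRank A ψ := by
  have : amplitudes A (c • ψ) = c • amplitudes A ψ := by
    ext u v
    simp [amplitudes]
  rw [schmidtRank, this,
    Matrix.rank_smul_of_mem_nonZeroDivisors _ (mem_nonZeroDivisors_of_ne_zero hc)]
  rfl

/-- Moving sites across the cut multiplies the Schmidt rank by at most `d` for each site. -/
theorem schmidtRank_le_pow_mul (A B : Finset Λ) (ψ : State Λ d) :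
    schmidtRank A ψ ≤ d ^ ((A \ B).card + (B \ A).card) * schmidtRank B ψ := by
  classical
  let D := {x // x ∈ A \ B} → Fin d
  let D' := {x // x ∈ B \ A} → Fin d
  -- The block in which the sites changing sides take the prescribed values `p`. Within it those
  -- sites are constants, so it is a submatrix of the amplitudes across `B`, masked by diagonal
  -- projections.
  let N : D × D' → Matrix ({x // x ∈ A} → Fin d) ({x // x ∉ A} → Fin d) ℂ := fun p =>
    Matrix.diagonal (fun s : {x // x ∈ A} → Fin d => if ∀ x, ∀ hx : x ∈ A \ B,
        s ⟨x, (Finset.mem_sdiff.mp hx).1⟩ = p.1 ⟨x, hx⟩ then (1 : ℂ) else 0) *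
      (amplitudes B ψ).submatrix
        (fun (s : {x // x ∈ A} → Fin d) x => if hx : x.1 ∈ A then s ⟨x, hx⟩
          else p.2 ⟨x, Finset.mem_sdiff.mpr ⟨x.2, hx⟩⟩)
        (fun (u : {x // x ∉ A} → Fin d) x => if hx : x.1 ∈ A then p.1 ⟨x, Finset.mem_sdiff.mpr ⟨hx, x.2⟩⟩
          else u ⟨x, hx⟩) *
      Matrix.diagonal (fun u : {x // x ∉ A} → Fin d => if ∀ x, ∀ hx : x ∈ B \ A,
        u ⟨x, (Finset.mem_sdiff.mp hx).2⟩ = p.2 ⟨x, hx⟩ then (1 : ℂ) else 0)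
  have hsum : amplitudes A ψ = ∑ p, N p := by
    ext s u
    rw [Matrix.sum_apply, Finset.sum_eq_single
      ((fun x => s ⟨x, (Finset.mem_sdiff.mp x.2).1⟩,
        fun x => u ⟨x, (Finset.mem_sdiff.mp x.2).2⟩) : D × D')]
    · simp only [N, Matrix.mul_diagonal, Matrix.diagonal_mul, Matrix.submatrix_apply, amplitudes]
      simp only [implies_true, if_true, one_mul, mul_one]
      refine congrArg ψ.ofLp (funext fun x => ?_)
      by_cases hA : x ∈ A <;> by_cases hB : x ∈ B <;> simp [glue, hA, hB]
    · rintro ⟨p, p'⟩ - hp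
      simp only [N, Matrix.mul_diagonal, Matrix.diagonal_mul]
      by_cases h1 : ∀ x, ∀ hx : x ∈ A \ B, s ⟨x, (Finset.mem_sdiff.mp hx).1⟩ = p ⟨x, hx⟩
      · by_cases h2 : ∀ x, ∀ hx : x ∈ B \ A, u ⟨x, (Finset.mem_sdiff.mp hx).2⟩ = p' ⟨x, hx⟩
        · exact absurd (Prod.ext (funext fun x : {x // x ∈ A \ B} => (h1 x.1 x.2).symm)
            (funext fun x : {x // x ∈ B \ A} => (h2 x.1 x.2).symm)) hp
        · rw [if_neg h2, mul_zero]
      · rw [if_neg h1, zero_mul, zero_mul]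
    · simp
  have hcard : (Finset.univ : Finset (D × D')).card = d ^ ((A \ B).card + (B \ A).card) := by
    rw [Finset.card_univ, Fintype.card_prod]
    simp only [D, D', Fintype.card_fun, Fintype.card_coe, Fintype.card_fin, pow_add]
  rw [schmidtRank, hsum, ← hcard]
  refine rank_sum_le_card_mul _ _ _ fun p _ => ?_
  exact (Matrix.rank_mul_le_left _ _).trans
    ((Matrix.rank_mul_le_right _ _).trans (Matrix.rank_submatrix_le _ _ _))

/-! ### Words in the crossing terms. -/

section Words

open scoped Kronecker

variable {R α β C : Type*} [CommRing R] [Fintype α] [DecidableEq α] [Fintype β] [DecidableEq β]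
  [Fintype C]

open scoped Classical in
/-- The products `K ^ a₀ * Y c₁ * K ^ a₁ * ⋯ * Y cⱼ * K ^ aⱼ` with all exponents at most `k`. -/
def words (K : Matrix α α R) (Y : C → Matrix α α R) (k : ℕ) : ℕ → Finset (Matrix α α R)
  | 0 => (Finset.range (k + 1)).image (K ^ ·)
  | j + 1 => (Finset.range (k + 1) ×ˢ ((Finset.univ : Finset C) ×ˢ words K Y k j)).image
      fun p => K ^ p.1 * (Y p.2.1 * p.2.2)

theorem card_words_le (K : Matrix α α R) (Y : C → Matrix α α R) (k j : ℕ) :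
    (words K Y k j).card ≤ (k + 1) ^ (j + 1) * Fintype.card C ^ j := by
  classical
  induction j with
  | zero => simpa [words] using (Finset.card_image_le (s := Finset.range (k + 1)) (f := (K ^ ·)))
  | succ j ih =>
    refine Finset.card_image_le.trans ?_
    rw [Finset.card_product, Finset.card_product, Finset.card_range, Finset.card_univ]
    calc (k + 1) * (Fintype.card C * (words K Y k j).card)
        ≤ (k + 1) * (Fintype.card C * ((k + 1) ^ (j + 1) * Fintype.card C ^ j)) := by gcongr
      _ = _ := by ring

theorem words_mono (K : Matrix α α R) (Y : C → Matrix α α R) {k l : ℕ} (h : k ≤ l) (j : ℕ) :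
    words K Y k j ⊆ words K Y l j := by
  classical
  have hr : Finset.range (k + 1) ⊆ Finset.range (l + 1) := Finset.range_mono (by omega)
  induction j with
  | zero => exact Finset.image_subset_image hr
  | succ j ih =>
    exact Finset.image_subset_image
      (Finset.product_subset_product hr (Finset.product_subset_product_right ih))

theorem mul_mem_words {K : Matrix α α R} {Y : C → Matrix α α R} {k j : ℕ} {w : Matrix α α R}
    (hw : w ∈ words K Y k j) : K * w ∈ words K Y (k + 1) j := by
  classical
  cases j with
  | zero =>
    obtain ⟨a, ha, rfl⟩ := Finset.mem_image.mp hw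
    refine Finset.mem_image.mpr ⟨a + 1, ?_, pow_succ' K a⟩
    rw [Finset.mem_range] at ha ⊢
    omega
  | succ j =>
    obtain ⟨⟨a, c, v⟩, ha, rfl⟩ := Finset.mem_image.mp hw
    simp only [Finset.mem_product, Finset.mem_range] at ha
    refine Finset.mem_image.mpr ⟨(a + 1, c, v), ?_, ?_⟩
    · simp only [Finset.mem_product, Finset.mem_range]
      exact ⟨by omega, ha.2.1, words_mono K Y (Nat.le_succ k) j ha.2.2⟩
    · rw [pow_succ', mul_assoc]

theorem letter_mul_mem_words {K : Matrix α α R} {Y : C → Matrix α α R} {k j : ℕ}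
    {w : Matrix α α R} (hw : w ∈ words K Y k j) (c : C) : Y c * w ∈ words K Y k (j + 1) := by
  classical
  exact Finset.mem_image.mpr ⟨(0, c, w), by simp [hw], by simp⟩

/-- The operators on a bipartite space that are sums of products whose left factors are words, a
word with `j` letters coming with a factor `z ^ j`. -/
def wordSpan (z : R) (K : Matrix α α R) (Y : C → Matrix α α R) (β : Type*) (k : ℕ) :
    AddSubmonoid (Matrix (α × β) (α × β) R) :=
  AddSubmonoid.closure {O | ∃ j, ∃ w ∈ words K Y k j, ∃ r : Matrix β β R, O = z ^ j • (w ⊗ₖ r)}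

theorem wordSpan_mono (z : R) (K : Matrix α α R) (Y : C → Matrix α α R) {k l : ℕ} (h : k ≤ l) :
    wordSpan z K Y β k ≤ wordSpan z K Y β l := by
  apply AddSubmonoid.closure_mono
  rintro O ⟨j, w, hw, r, rfl⟩
  exact ⟨j, w, words_mono K Y h j hw, r, rfl⟩

theorem smul_mem_wordSpan (a : R) {z : R} {K : Matrix α α R} {Y : C → Matrix α α R} {k : ℕ}
    {O : Matrix (α × β) (α × β) R} (hO : O ∈ wordSpan z K Y β k) : a • O ∈ wordSpan z K Y β k := by
  induction hO using AddSubmonoid.closure_induction with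
  | mem O hO =>
    obtain ⟨j, w, hw, r, rfl⟩ := hO
    refine AddSubmonoid.subset_closure ⟨j, w, hw, a • r, ?_⟩
    rw [Matrix.kronecker_smul, smul_comm]
  | zero => rw [smul_zero]; exact zero_mem _
  | add O O' _ _ ih ih' => rw [smul_add]; exact add_mem ih ih'

/-- Multiplying by `K ⊗ 1` lengthens the leading power, by `1 ⊗ K'` changes only the right factor,
and by a crossing term adds one letter and one `z`. Right factors are unrestricted, so the positions
of `K'` need not be recorded; this is what keeps the words few. -/
theorem pow_mem_wordSpan (z : R) (K : Matrix α α R) (K' : Matrix β β R) (Y : C → Matrix α α R)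
    (Z : C → Matrix β β R) (k : ℕ) :
    (K ⊗ₖ (1 : Matrix β β R) + (1 : Matrix α α R) ⊗ₖ K' + z • ∑ c, Y c ⊗ₖ Z c) ^ k ∈
      wordSpan z K Y β k := by
  classical
  induction k with
  | zero =>
    refine AddSubmonoid.subset_closure ⟨0, 1, Finset.mem_image.mpr ⟨0, by simp⟩, 1, ?_⟩
    simp
  | succ k ih =>
    rw [pow_succ']
    generalize (K ⊗ₖ (1 : Matrix β β R) + (1 : Matrix α α R) ⊗ₖ K' +
      z • ∑ c, Y c ⊗ₖ Z c) ^ k = O at ih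
    induction ih using AddSubmonoid.closure_induction with
    | mem O hO =>
      obtain ⟨j, w, hw, r, rfl⟩ := hO
      rw [add_mul, add_mul, Matrix.mul_smul, ← Matrix.mul_kronecker_mul, Matrix.mul_smul,
        ← Matrix.mul_kronecker_mul, one_mul, one_mul, Matrix.smul_mul, Matrix.mul_smul,
        Finset.sum_mul, Finset.smul_sum, Finset.smul_sum]
      refine add_mem (add_mem ?_ ?_) (sum_mem fun c _ => ?_)
      · exact AddSubmonoid.subset_closure ⟨j, _, mul_mem_words hw, r, rfl⟩
      · exact AddSubmonoid.subset_closure ⟨j, _, words_mono K Y (Nat.le_succ k) j hw, _, rfl⟩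
      · refine AddSubmonoid.subset_closure ⟨j + 1, _,
          words_mono K Y (Nat.le_succ k) _ (letter_mul_mem_words hw c), Z c * r, ?_⟩
        rw [← Matrix.mul_kronecker_mul, smul_smul, pow_succ']
    | zero => rw [mul_zero]; exact zero_mem _
    | add O O' _ _ ih ih' => rw [mul_add]; exact add_mem ih ih'

theorem aeval_mem_wordSpan {𝕜 : Type*} [CommRing 𝕜] [Algebra 𝕜 R] (z : R) (K : Matrix α α R)
    (K' : Matrix β β R) (Y : C → Matrix α α R) (Z : C → Matrix β β R) (P : Polynomial 𝕜) {l : ℕ}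
    (hP : P.natDegree ≤ l) :
    Polynomial.aeval
      (K ⊗ₖ (1 : Matrix β β R) + (1 : Matrix α α R) ⊗ₖ K' + z • ∑ c, Y c ⊗ₖ Z c) P ∈
      wordSpan z K Y β l := by
  rw [Polynomial.aeval_eq_sum_range]
  refine sum_mem fun k hk => ?_
  rw [← algebraMap_smul R]
  refine smul_mem_wordSpan _ (wordSpan_mono _ _ _ ?_ (pow_mem_wordSpan _ _ _ _ _ k))
  rw [Finset.mem_range] at hk
  omega

end Words

/-! ### Sums of product operators and extraction of coefficients. -/

section Product

open scoped Kronecker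

variable {α β : Type*} [Fintype α] [DecidableEq α] [Fintype β] [DecidableEq β]

/-- The operators `∑ L ∈ S, L ⊗ r L` on a bipartite space. -/
def productSpan (S : Finset (Matrix α α ℂ)) (β : Type*) :
    AddSubmonoid (Matrix (α × β) (α × β) ℂ) :=
  AddSubmonoid.closure {O | ∃ L ∈ S, ∃ r : Matrix β β ℂ, O = L ⊗ₖ r}

/-- Products with a common left factor merge by adding the right factors, so only the number of left
factors matters. -/
theorem exists_eq_sum_of_mem_productSpan {S : Finset (Matrix α α ℂ)}
    {O : Matrix (α × β) (α × β) ℂ} (hO : O ∈ productSpan S β) :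
    ∃ r : Matrix α α ℂ → Matrix β β ℂ, O = ∑ L ∈ S, L ⊗ₖ r L := by
  classical
  induction hO using AddSubmonoid.closure_induction with
  | mem O hO =>
    obtain ⟨L, hL, r, rfl⟩ := hO
    refine ⟨Pi.single L r, ?_⟩
    rw [Finset.sum_eq_single L (fun L' _ h => ?_) (fun h => absurd hL h), Pi.single_eq_same]
    rw [Pi.single_eq_of_ne h, Matrix.kronecker_zero]
  | zero => exact ⟨0, by simp⟩
  | add O O' _ _ ih ih' =>
    obtain ⟨r, rfl⟩ := ih
    obtain ⟨r', rfl⟩ := ih'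
    exact ⟨r + r', by simp [Matrix.kronecker_add, Finset.sum_add_distrib]⟩

/-- The rank of a bipartite vector grows at most by the number of product terms of the operator
applied to it. -/
theorem rank_mulVec_le_of_mem_productSpan {S : Finset (Matrix α α ℂ)}
    {O : Matrix (α × β) (α × β) ℂ} (hO : O ∈ productSpan S β) (ψ : α × β → ℂ) :
    (Matrix.of fun a b => (O.mulVec ψ) (a, b)).rank ≤
      S.card * (Matrix.of fun a b => ψ (a, b)).rank := by
  obtain ⟨r, rfl⟩ := exists_eq_sum_of_mem_productSpan hO
  have : (Matrix.of fun a b => ((∑ L ∈ S, L ⊗ₖ r L).mulVec ψ) (a, b)) =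
      ∑ L ∈ S, L * (Matrix.of fun a b => ψ (a, b)) * (r L).transpose := by
    ext a b
    rw [Matrix.sum_apply, Matrix.of_apply, Matrix.sum_mulVec, Finset.sum_apply]
    refine Finset.sum_congr rfl fun L _ => ?_
    simp only [Matrix.mulVec, dotProduct, Matrix.mul_apply, Fintype.sum_prod_type,
      Matrix.kroneckerMap_apply, Matrix.of_apply, Matrix.transpose_apply, Finset.sum_mul]
    rw [Finset.sum_comm]
    refine Finset.sum_congr rfl fun _ _ => Finset.sum_congr rfl fun _ _ => by ring
  rw [this]
  exact rank_sum_le_card_mul _ _ _ fun L _ =>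
    (Matrix.rank_mul_le_left _ _).trans (Matrix.rank_mul_le_right _ _)

variable {Q C : Type*} [Fintype Q] [DecidableEq Q] [Fintype C]

/-- The multi-indices all of whose entries are at most `l`. -/
def exponentBox (Q : Type*) [Fintype Q] [DecidableEq Q] (l : ℕ) : Finset (Q →₀ ℕ) :=
  Finset.Iic (Finsupp.equivFunOnFinite.symm fun _ => l)

theorem mem_exponentBox {l : ℕ} {n : Q →₀ ℕ} : n ∈ exponentBox Q l ↔ ∀ q, n q ≤ l := by
  simp [exponentBox, Finsupp.le_def]

theorem card_exponentBox (l : ℕ) : (exponentBox Q l).card = (l + 1) ^ Fintype.card Q := by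
  rw [exponentBox, Finsupp.card_Iic, Finset.prod_subset (Finset.subset_univ _)]
  · simp
  · intro q _ hq
    rw [Finsupp.notMem_support_iff.mp hq]
    simp

/-- The coefficients of the words with at most `t` letters. -/
def wordCoeffs (K : Matrix α α (MvPolynomial Q ℂ)) (Y : C → Matrix α α (MvPolynomial Q ℂ))
    (l t : ℕ) : Finset (Matrix α α ℂ) := by
  classical
  exact (((Finset.range (t + 1)).biUnion (words K Y l)) ×ˢ exponentBox Q l).image
    fun p => p.1.map (MvPolynomial.coeff p.2)

theorem card_wordCoeffs_le (K : Matrix α α (MvPolynomial Q ℂ))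
    (Y : C → Matrix α α (MvPolynomial Q ℂ)) (l t : ℕ) :
    (wordCoeffs K Y l t).card ≤
      (∑ j ∈ Finset.range (t + 1), (l + 1) ^ (j + 1) * Fintype.card C ^ j) *
        (l + 1) ^ Fintype.card Q := by
  classical
  refine Finset.card_image_le.trans ?_
  rw [Finset.card_product, card_exponentBox]
  gcongr
  exact Finset.card_biUnion_le.trans (Finset.sum_le_sum fun j _ => card_words_le K Y l j)

/-- A word with more than `t` letters carries a power of `X q` exceeding `n q` and contributes
nothing. For the others the power of `X q` is absorbed into the right factor, and the coefficient of
the product is a convolution over indices below `n`. -/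
theorem map_coeff_mem_productSpan {K : Matrix α α (MvPolynomial Q ℂ)}
    {Y : C → Matrix α α (MvPolynomial Q ℂ)} {l t : ℕ} {q : Q} {n : Q →₀ ℕ}
    (hn : n ∈ exponentBox Q l) (hq : n q ≤ t) {O : Matrix (α × β) (α × β) (MvPolynomial Q ℂ)}
    (hO : O ∈ wordSpan (MvPolynomial.X q) K Y β l) :
    O.map (MvPolynomial.coeff n) ∈ productSpan (wordCoeffs K Y l t) β := by
  classical
  induction hO using AddSubmonoid.closure_induction with
  | mem O hO =>
    obtain ⟨j, w, hw, r, rfl⟩ := hO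
    by_cases hj : j ≤ t
    · have : (((MvPolynomial.X q : MvPolynomial Q ℂ) ^ j) • (w ⊗ₖ r)).map (MvPolynomial.coeff n) =
          ∑ p ∈ Finset.HasAntidiagonal.antidiagonal n, w.map (MvPolynomial.coeff p.1) ⊗ₖ
            ((MvPolynomial.X q : MvPolynomial Q ℂ) ^ j • r).map (MvPolynomial.coeff p.2) := by
        rw [← Matrix.kronecker_smul]
        ext a b
        rw [Matrix.sum_apply, Matrix.map_apply, Matrix.kroneckerMap_apply, MvPolynomial.coeff_mul]
        rfl
      rw [this]
      refine sum_mem fun p hp => AddSubmonoid.subset_closure ⟨_, ?_, _, rfl⟩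
      refine Finset.mem_image.mpr ⟨(w, p.1), Finset.mem_product.mpr
        ⟨Finset.mem_biUnion.mpr ⟨j, Finset.mem_range.mpr (by omega), hw⟩, ?_⟩, rfl⟩
      rw [mem_exponentBox] at hn ⊢
      intro q'
      have := DFunLike.congr_fun (Finset.HasAntidiagonal.mem_antidiagonal.mp hp) q'
      rw [Finsupp.add_apply] at this
      exact (Nat.le_add_right _ _).trans (this.le.trans (hn q'))
    · convert zero_mem (productSpan (wordCoeffs K Y l t) β)
      ext a b
      rw [Matrix.map_apply, Matrix.smul_apply, smul_eq_mul, MvPolynomial.X_pow_eq_monomial,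
        MvPolynomial.coeff_monomial_mul', if_neg, Matrix.zero_apply]
      intro hle
      have := hle q
      simp at this
      omega
  | zero =>
    convert zero_mem (productSpan (wordCoeffs K Y l t) β)
    ext a b
    simp
  | add O O' _ _ ih ih' =>
    convert add_mem ih ih' using 1
    ext a b
    simp

end Product

open scoped Kronecker

/-! ### Local terms with respect to a bipartition. -/

section Bipartite

variable {Λ : Type*} [Fintype Λ] [DecidableEq Λ] {d : ℕ}

/-- A configuration is a configuration of `A` together with one of the complement. -/
def splitEquiv (A : Finset Λ) (d : ℕ) :
    Config Λ d ≃ ({x // x ∈ A} → Fin d) × ({x // x ∉ A} → Fin d) :=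
  Equiv.piEquivPiSubtypeProd (· ∈ A) fun _ => Fin d

/-- An operator as a matrix in the product basis of the bipartition into `A` and its complement. -/
def bipartite {R : Type*} [CommSemiring R] (A : Finset Λ) :
    Matrix (Config Λ d) (Config Λ d) R ≃ₐ[R]
      Matrix (({x // x ∈ A} → Fin d) × ({x // x ∉ A} → Fin d))
        (({x // x ∈ A} → Fin d) × ({x // x ∉ A} → Fin d)) R :=
  Matrix.reindexAlgEquiv R R (splitEquiv A d)

theorem bipartite_apply {R : Type*} [CommSemiring R] (A : Finset Λ)
    (O : Matrix (Config Λ d) (Config Λ d) R) (p p') :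
    bipartite A O p p' = O (glue A p.1 p.2) (glue A p'.1 p'.2) := rfl

theorem glue_apply_mem {A : Finset Λ} (s : {x // x ∈ A} → Fin d) (u : {x // x ∉ A} → Fin d)
    {x : Λ} (hx : x ∈ A) : glue A s u x = s ⟨x, hx⟩ := by simp [glue, hx]

theorem glue_apply_notMem {A : Finset Λ} (s : {x // x ∈ A} → Fin d) (u : {x // x ∉ A} → Fin d)
    {x : Λ} (hx : x ∉ A) : glue A s u x = u ⟨x, hx⟩ := by simp [glue, hx]

theorem forall_glue_eq_iff {A S : Finset Λ} (s t : {x // x ∈ A} → Fin d)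
    (u v : {x // x ∉ A} → Fin d) :
    (∀ x, x ∉ S → glue A s u x = glue A t v x) ↔
      (∀ x : {x // x ∈ A}, x.1 ∉ S → s x = t x) ∧ (∀ x : {x // x ∉ A}, x.1 ∉ S → u x = v x) := by
  constructor
  · intro h
    refine ⟨fun x hx => ?_, fun x hx => ?_⟩
    · simpa only [glue_apply_mem _ _ x.2] using h x hx
    · simpa only [glue_apply_notMem _ _ x.2] using h x hx
  · rintro ⟨h, h'⟩ x hx
    by_cases hA : x ∈ A
    · simpa only [glue_apply_mem _ _ hA] using h ⟨x, hA⟩ hx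
    · simpa only [glue_apply_notMem _ _ hA] using h' ⟨x, hA⟩ hx

theorem exists_bipartite_eq_kronecker_one {S A : Finset Λ} {O : Op Λ d}
    (hO : IsSupportedOn S O) (hS : S \ A = ∅) :
    ∃ L, bipartite A O = L ⊗ₖ (1 : Matrix ({x // x ∉ A} → Fin d) ({x // x ∉ A} → Fin d) ℂ) := by
  classical
  obtain ⟨K, hK⟩ := hO
  have hSA : ∀ x ∈ S, x ∈ A := fun x hx => by
    by_contra hA
    exact Finset.notMem_empty x (hS ▸ Finset.mem_sdiff.mpr ⟨hx, hA⟩)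
  refine ⟨Matrix.of fun s t => if ∀ x : {x // x ∈ A}, x.1 ∉ S → s x = t x then
    K (fun x : S => s ⟨x, hSA x x.2⟩) (fun x : S => t ⟨x, hSA x x.2⟩) else 0, ?_⟩
  ext ⟨s, u⟩ ⟨t, v⟩
  rw [bipartite_apply, hK, Matrix.kroneckerMap_apply, Matrix.of_apply, Matrix.one_apply]
  have huv : (∀ x : {x // x ∉ A}, x.1 ∉ S → u x = v x) ↔ u = v :=
    ⟨fun h => funext fun x : {x // x ∉ A} => h x fun hx => x.2 (hSA x hx), fun h x _ => h ▸ rfl⟩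
  simp only [forall_glue_eq_iff, huv]
  have hr : ∀ (s : {x // x ∈ A} → Fin d) (u : {x // x ∉ A} → Fin d),
      (fun x : S => glue A s u x) = fun x : S => s ⟨x, hSA x x.2⟩ :=
    fun s u => funext fun x => glue_apply_mem s u _
  rw [hr, hr, mul_ite, mul_one, mul_zero, ← ite_and]
  exact if_congr and_comm rfl rfl

theorem exists_bipartite_eq_one_kronecker {S A : Finset Λ} {O : Op Λ d}
    (hO : IsSupportedOn S O) (hS : S ∩ A = ∅) :
    ∃ L, bipartite A O = (1 : Matrix ({x // x ∈ A} → Fin d) ({x // x ∈ A} → Fin d) ℂ) ⊗ₖ L := by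
  classical
  obtain ⟨K, hK⟩ := hO
  have hSA : ∀ x ∈ S, x ∉ A := fun x hx hA =>
    Finset.notMem_empty x (hS ▸ Finset.mem_inter.mpr ⟨hx, hA⟩)
  refine ⟨Matrix.of fun s t => if ∀ x : {x // x ∉ A}, x.1 ∉ S → s x = t x then
    K (fun x : S => s ⟨x, hSA x x.2⟩) (fun x : S => t ⟨x, hSA x x.2⟩) else 0, ?_⟩
  ext ⟨s, u⟩ ⟨t, v⟩
  rw [bipartite_apply, hK, Matrix.kroneckerMap_apply, Matrix.of_apply, Matrix.one_apply]
  have hst : (∀ x : {x // x ∈ A}, x.1 ∉ S → s x = t x) ↔ s = t :=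
    ⟨fun h => funext fun x : {x // x ∈ A} => h x fun hx => hSA x hx x.2, fun h x _ => h ▸ rfl⟩
  simp only [forall_glue_eq_iff, hst]
  have hr : ∀ (s : {x // x ∈ A} → Fin d) (u : {x // x ∉ A} → Fin d),
      (fun x : S => glue A s u x) = fun x : S => u ⟨x, hSA x x.2⟩ :=
    fun s u => funext fun x => glue_apply_notMem s u _
  rw [hr, hr, ite_mul, one_mul, zero_mul, ite_and]

/-- Padding with zero products lets all local terms share the index type `Fin (d ^ b)`. -/
theorem exists_sum_kronecker_of_card_le {α β ι : Type*} [Fintype ι] {n : ℕ}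
    (hn : Fintype.card ι ≤ n) (Y : ι → Matrix α α ℂ) (Z : ι → Matrix β β ℂ) :
    ∃ (Y' : Fin n → Matrix α α ℂ) (Z' : Fin n → Matrix β β ℂ),
      ∑ i, Y i ⊗ₖ Z i = ∑ i, Y' i ⊗ₖ Z' i := by
  obtain ⟨f⟩ : Nonempty (ι ↪ Fin n) := Function.Embedding.nonempty_of_card_le (by simpa using hn)
  refine ⟨Function.extend f Y 0, Function.extend f Z 0, ?_⟩
  refine Fintype.sum_of_injective f f.injective _ _ (fun i hi => ?_) fun i => ?_
  · rw [Function.extend_apply' _ _ _ (by simpa using hi)]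
    simp
  · rw [f.injective.extend_apply, f.injective.extend_apply]

/-- An operator supported on at most `b` sites is a sum of `d ^ b` product operators with respect
to any bipartition. -/
theorem exists_bipartite_eq_sum_kronecker {S : Finset Λ} {O : Op Λ d} (hO : IsSupportedOn S O)
    (hd : 0 < d) {b : ℕ} (hb : S.card ≤ b) (A : Finset Λ) :
    ∃ (Y : Fin (d ^ b) → Matrix ({x // x ∈ A} → Fin d) ({x // x ∈ A} → Fin d) ℂ)
      (Z : Fin (d ^ b) → Matrix ({x // x ∉ A} → Fin d) ({x // x ∉ A} → Fin d) ℂ),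
      bipartite A O = ∑ i, Y i ⊗ₖ Z i := by
  classical
  obtain ⟨K, hK⟩ := hO
  have hcard := Finset.card_inter_add_card_sdiff S A
  have hcount : ∀ T : Finset Λ, 2 * T.card ≤ b →
      Fintype.card ((T → Fin d) × (T → Fin d)) ≤ d ^ b := fun T hT => by
    rw [Fintype.card_prod, Fintype.card_fun, Fintype.card_coe, Fintype.card_fin, ← pow_add]
    exact Nat.pow_le_pow_right hd (by omega)
  -- Matrix units are taken on the smaller part of `S`, which has at most `b / 2` sites, hence at
  -- most `d ^ b` pairs of configurations.
  rcases le_total (S ∩ A).card (S \ A).card with hle | hle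
  · let D := {x // x ∈ S ∩ A} → Fin d
    let ρ : ({x // x ∈ A} → Fin d) → D := fun s x => s ⟨x, (Finset.mem_inter.mp x.2).2⟩
    let j : D → ({x // x ∉ A} → Fin d) → S → Fin d := fun p u x =>
      if hx : x.1 ∈ A then p ⟨x, Finset.mem_inter.mpr ⟨x.2, hx⟩⟩ else u ⟨x, hx⟩
    have hsum : bipartite A O = ∑ p : D × D,
        (Matrix.of fun s t => if ρ s = p.1 ∧ ρ t = p.2 then
          if ∀ x : {x // x ∈ A}, x.1 ∉ S → s x = t x then 1 else 0 else 0) ⊗ₖ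
        (Matrix.of fun u v => if ∀ x : {x // x ∉ A}, x.1 ∉ S → u x = v x then
          K (j p.1 u) (j p.2 v) else 0) := by
      ext ⟨s, u⟩ ⟨t, v⟩
      rw [Matrix.sum_apply, Finset.sum_eq_single ((ρ s, ρ t) : D × D)]
      · rw [bipartite_apply, hK, Matrix.kroneckerMap_apply, Matrix.of_apply, Matrix.of_apply]
        simp only [forall_glue_eq_iff, and_self, if_true, ite_and, ite_mul, one_mul, zero_mul]
        congr
      · rintro ⟨p, p'⟩ - hp
        rw [Matrix.kroneckerMap_apply, Matrix.of_apply, if_neg, zero_mul]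
        rintro ⟨h, h'⟩
        exact hp (Prod.ext h.symm h'.symm)
      · simp
    rw [hsum]
    exact exists_sum_kronecker_of_card_le (hcount (S ∩ A) (by omega)) _ _
  · let D := {x // x ∈ S \ A} → Fin d
    let ρ : ({x // x ∉ A} → Fin d) → D := fun s x => s ⟨x, (Finset.mem_sdiff.mp x.2).2⟩
    let j : D → ({x // x ∈ A} → Fin d) → S → Fin d := fun p u x =>
      if hx : x.1 ∈ A then u ⟨x, hx⟩ else p ⟨x, Finset.mem_sdiff.mpr ⟨x.2, hx⟩⟩
    have hsum : bipartite A O = ∑ p : D × D,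
        (Matrix.of fun s t => if ∀ x : {x // x ∈ A}, x.1 ∉ S → s x = t x then
          K (j p.1 s) (j p.2 t) else 0) ⊗ₖ
        (Matrix.of fun u v => if ρ u = p.1 ∧ ρ v = p.2 then
          if ∀ x : {x // x ∉ A}, x.1 ∉ S → u x = v x then 1 else 0 else 0) := by
      ext ⟨s, u⟩ ⟨t, v⟩
      rw [Matrix.sum_apply, Finset.sum_eq_single ((ρ u, ρ v) : D × D)]
      · rw [bipartite_apply, hK, Matrix.kroneckerMap_apply, Matrix.of_apply, Matrix.of_apply]
        simp only [forall_glue_eq_iff, and_self, if_true]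
        rw [mul_ite, mul_one, mul_zero, ← ite_and]
        refine if_congr and_comm ?_ rfl
        congr
      · rintro ⟨p, p'⟩ - hp
        rw [Matrix.kroneckerMap_apply, Matrix.of_apply, Matrix.of_apply, mul_eq_zero]
        refine Or.inr (if_neg ?_)
        rintro ⟨h, h'⟩
        exact hp (Prod.ext h.symm h'.symm)
      · simp
    rw [hsum]
    exact exists_sum_kronecker_of_card_le (hcount (S \ A) (by omega)) _ _

/-- A weighted sum of local terms, all those across the cut having the same weight `z`. -/
theorem exists_bipartite_weighted_sum {b : ℕ} {h : ℝ} (H : LocalHamiltonian Λ d b h) (hd : 0 < d)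
    {σ : Type*} (w : Λ → MvPolynomial σ ℂ) (A : Finset Λ) (z : MvPolynomial σ ℂ)
    (hw : ∀ x ∈ H.crossing A, w x = z) :
    ∃ (K : Matrix ({x // x ∈ A} → Fin d) ({x // x ∈ A} → Fin d) (MvPolynomial σ ℂ))
      (K' : Matrix ({x // x ∉ A} → Fin d) ({x // x ∉ A} → Fin d) (MvPolynomial σ ℂ))
      (Y : {x // x ∈ H.crossing A} × Fin (d ^ b) →
        Matrix ({x // x ∈ A} → Fin d) ({x // x ∈ A} → Fin d) (MvPolynomial σ ℂ))
      (Z : {x // x ∈ H.crossing A} × Fin (d ^ b) →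
        Matrix ({x // x ∉ A} → Fin d) ({x // x ∉ A} → Fin d) (MvPolynomial σ ℂ)),
      bipartite A (∑ x, w x • (H.term x).map MvPolynomial.C) =
      K ⊗ₖ (1 : Matrix ({x // x ∉ A} → Fin d) ({x // x ∉ A} → Fin d) (MvPolynomial σ ℂ)) +
      (1 : Matrix ({x // x ∈ A} → Fin d) ({x // x ∈ A} → Fin d) (MvPolynomial σ ℂ)) ⊗ₖ K' +
      z • ∑ c, Y c ⊗ₖ Z c := by
  classical
  choose Y Z hYZ using fun x => exists_bipartite_eq_sum_kronecker (H.isSupportedOn x) hd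
    (H.card_supp_le x) A
  have hL : ∀ x, ∃ L, H.supp x \ A = ∅ → bipartite A (H.term x) = L ⊗ₖ 1 := fun x => by
    by_cases hx : H.supp x \ A = ∅
    · obtain ⟨L, hL⟩ := exists_bipartite_eq_kronecker_one (H.isSupportedOn x) hx
      exact ⟨L, fun _ => hL⟩
    · exact ⟨0, fun h => absurd h hx⟩
  have hL' : ∀ x, ∃ L, H.supp x ∩ A = ∅ → bipartite A (H.term x) = 1 ⊗ₖ L := fun x => by
    by_cases hx : H.supp x ∩ A = ∅
    · obtain ⟨L, hL⟩ := exists_bipartite_eq_one_kronecker (H.isSupportedOn x) hx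
      exact ⟨L, fun _ => hL⟩
    · exact ⟨0, fun h => absurd h hx⟩
  choose L hL using hL
  choose L' hL' using hL'
  have hmap : ∀ x, bipartite A (w x • (H.term x).map (MvPolynomial.C (R := ℂ) (σ := σ))) =
      w x • (bipartite A (H.term x)).map MvPolynomial.C := fun x => by
    rw [map_smul]
    rfl
  -- A term that does not cross is supported inside `A` or inside its complement; empty supports are
  -- assigned to `A`.
  refine ⟨∑ x ∈ (Finset.univ \ H.crossing A).filter (fun x => H.supp x \ A = ∅),
      w x • (L x).map MvPolynomial.C,
    ∑ x ∈ (Finset.univ \ H.crossing A).filter (fun x => ¬ H.supp x \ A = ∅),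
      w x • (L' x).map MvPolynomial.C,
    fun c => (Y c.1 c.2).map MvPolynomial.C, fun c => (Z c.1 c.2).map MvPolynomial.C, ?_⟩
  rw [map_sum, ← Finset.sum_sdiff (Finset.subset_univ (H.crossing A)),
    ← Finset.sum_filter_add_sum_filter_not _ (fun x => H.supp x \ A = ∅)]
  congr 1
  · congr 1
    · ext ⟨s, u⟩ ⟨t, v⟩
      simp only [Matrix.sum_apply, Matrix.kroneckerMap_apply, Finset.sum_mul]
      rw [Finset.sum_congr rfl]
      intro x hx
      rw [hmap, hL x (Finset.mem_filter.mp hx).2]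
      by_cases huv : u = v <;> simp [Matrix.one_apply, huv]
    · ext ⟨s, u⟩ ⟨t, v⟩
      simp only [Matrix.sum_apply, Matrix.kroneckerMap_apply, Finset.mul_sum]
      rw [Finset.sum_congr rfl]
      intro x hx
      have hx' : H.supp x ∩ A = ∅ := by
        simp only [Finset.mem_filter, Finset.mem_sdiff, Finset.mem_univ, true_and,
          LocalHamiltonian.crossing, ← Finset.nonempty_iff_ne_empty] at hx
        rw [← Finset.not_nonempty_iff_eq_empty]
        exact fun h => hx.1 ⟨h, hx.2⟩
      rw [hmap, hL' x hx']
      by_cases hst : s = t <;> simp [Matrix.one_apply, hst]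
  · rw [Fintype.sum_prod_type, Finset.smul_sum, ← Finset.sum_coe_sort]
    refine Finset.sum_congr rfl fun x _ => ?_
    rw [hmap, hw x x.2, hYZ]
    congr 1
    ext p p'
    simp [Matrix.sum_apply]

end Bipartite

/-! ### The marked Hamiltonian and the pigeonhole over cuts. -/

section Cuts

variable {Λ : Type*} [Fintype Λ] [DecidableEq Λ] {d : ℕ}

theorem schmidtRank_act_le {A : Finset Λ} {O : Op Λ d}
    {T : Finset (Matrix ({x // x ∈ A} → Fin d) ({x // x ∈ A} → Fin d) ℂ)}
    (hO : bipartite A O ∈ productSpan T ({x // x ∉ A} → Fin d)) (ψ : State Λ d) :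
    schmidtRank A (O.act ψ) ≤ T.card * schmidtRank A ψ := by
  have hM : amplitudes A (O.act ψ) = Matrix.of fun s u =>
      ((bipartite A O).mulVec fun p => ψ ((splitEquiv A d).symm p)) (s, u) := by
    ext s u
    rw [Matrix.of_apply]
    change (O.act ψ) (glue A s u) = _
    simp only [Op.act, Matrix.ofLp_toEuclideanCLM, Matrix.mulVec, dotProduct]
    rw [← (splitEquiv A d).symm.sum_comp]
    rfl
  rw [schmidtRank, hM]
  exact rank_mulVec_le_of_mem_productSpan hO fun p => ψ ((splitEquiv A d).symm p)

theorem eval_one_eq_sum_exponentBox {Q : Type*} [Fintype Q] [DecidableEq Q] {l : ℕ}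
    {p : MvPolynomial Q ℂ} (hp : p.totalDegree ≤ l) :
    MvPolynomial.eval (fun _ => 1) p = ∑ n ∈ exponentBox Q l, p.coeff n := by
  rw [MvPolynomial.eval_eq]
  simp only [one_pow, Finset.prod_const_one, mul_one]
  refine Finset.sum_subset (fun n hn => ?_) fun n _ hn => MvPolynomial.notMem_support_iff.mp hn
  rw [mem_exponentBox]
  intro q
  have h := (MvPolynomial.le_totalDegree hn).trans hp
  rw [Finsupp.sum_fintype _ _ fun _ => rfl] at h
  exact (Finset.single_le_sum (fun _ _ => Nat.zero_le _) (Finset.mem_univ q)).trans h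

theorem totalDegree_pow_apply_le {α σ : Type*} [Fintype α] [DecidableEq α]
    {M : Matrix α α (MvPolynomial σ ℂ)} (hM : ∀ s t, (M s t).totalDegree ≤ 1) (k : ℕ) (s t : α) :
    ((M ^ k) s t).totalDegree ≤ k := by
  induction k generalizing s t with
  | zero =>
    rw [pow_zero, Matrix.one_apply]
    split_ifs <;> simp
  | succ k ih =>
    rw [pow_succ, Matrix.mul_apply]
    exact MvPolynomial.totalDegree_finsetSum_le fun r _ =>
      (MvPolynomial.totalDegree_mul _ _).trans (add_le_add (ih s r) (hM r t))

theorem totalDegree_aeval_apply_le {α σ : Type*} [Fintype α] [DecidableEq α]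
    {M : Matrix α α (MvPolynomial σ ℂ)} (hM : ∀ s t, (M s t).totalDegree ≤ 1) {l : ℕ}
    {P : Polynomial ℂ} (hP : P.natDegree ≤ l) (s t : α) :
    ((Polynomial.aeval M P) s t).totalDegree ≤ l := by
  rw [Polynomial.aeval_eq_sum_range, Matrix.sum_apply]
  refine MvPolynomial.totalDegree_finsetSum_le fun k hk => ?_
  rw [Matrix.smul_apply]
  refine (MvPolynomial.totalDegree_smul_le _ _).trans
    ((totalDegree_pow_apply_le hM k s t).trans ?_)
  rw [Finset.mem_range] at hk
  omega

variable {Q : Type*} [Fintype Q] [DecidableEq Q] {b : ℕ} {h : ℝ}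

/-- The variables of the cuts that a local term crosses. -/
def cutWeight (H : LocalHamiltonian Λ d b h) (cut : Q → Finset Λ) (x : Λ) : MvPolynomial Q ℂ :=
  ∏ q with x ∈ H.crossing (cut q), MvPolynomial.X q

/-- The Hamiltonian in which every term is marked by the variable of the cut that it crosses. -/
def markedTotal (H : LocalHamiltonian Λ d b h) (cut : Q → Finset Λ) :
    Matrix (Config Λ d) (Config Λ d) (MvPolynomial Q ℂ) :=
  ∑ x, cutWeight H cut x • (H.term x).map MvPolynomial.C

/-- Every local term crosses at most one of the cuts. -/
def DisjointCrossings (H : LocalHamiltonian Λ d b h) (cut : Q → Finset Λ) : Prop :=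
  ∀ x q q', x ∈ H.crossing (cut q) → x ∈ H.crossing (cut q') → q = q'

theorem cutWeight_eq_X {H : LocalHamiltonian Λ d b h} {cut : Q → Finset Λ}
    (hcut : DisjointCrossings H cut) {x : Λ} {q : Q} (hx : x ∈ H.crossing (cut q)) :
    cutWeight H cut x = MvPolynomial.X q := by
  have : (Finset.univ.filter fun q => x ∈ H.crossing (cut q)) = {q} := by
    ext q'
    simp only [Finset.mem_filter, Finset.mem_univ, true_and, Finset.mem_singleton]
    exact ⟨fun h' => hcut x q' q h' hx, fun h' => h' ▸ hx⟩
  rw [cutWeight, this, Finset.prod_singleton]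

theorem totalDegree_cutWeight_le {H : LocalHamiltonian Λ d b h} {cut : Q → Finset Λ}
    (hcut : DisjointCrossings H cut) (x : Λ) : (cutWeight H cut x).totalDegree ≤ 1 := by
  by_cases hx : ∃ q, x ∈ H.crossing (cut q)
  · obtain ⟨q, hq⟩ := hx
    rw [cutWeight_eq_X hcut hq, MvPolynomial.totalDegree_X]
  · push Not at hx
    rw [cutWeight, Finset.filter_false_of_mem fun q _ => hx q, Finset.prod_empty]
    simp

theorem totalDegree_markedTotal_le {H : LocalHamiltonian Λ d b h} {cut : Q → Finset Λ}
    (hcut : DisjointCrossings H cut) (s t : Config Λ d) :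
    (markedTotal H cut s t).totalDegree ≤ 1 := by
  rw [markedTotal, Matrix.sum_apply]
  refine MvPolynomial.totalDegree_finsetSum_le fun x _ => ?_
  rw [Matrix.smul_apply, Matrix.map_apply, smul_eq_mul]
  refine (MvPolynomial.totalDegree_mul _ _).trans ?_
  rw [MvPolynomial.totalDegree_C, add_zero]
  exact totalDegree_cutWeight_le hcut x

theorem map_eval_markedTotal (H : LocalHamiltonian Λ d b h) (cut : Q → Finset Λ) :
    (markedTotal H cut).map (MvPolynomial.aeval fun _ => (1 : ℂ)) = H.total := by
  ext s t
  simp [markedTotal, LocalHamiltonian.total, Matrix.sum_apply, cutWeight]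

/-- Setting all variables to one is an algebra map that takes the marked Hamiltonian to `H`, hence
commutes with `P`; on each entry it sums the coefficients. -/
theorem aeval_total_eq_sum {H : LocalHamiltonian Λ d b h} {cut : Q → Finset Λ}
    (hcut : DisjointCrossings H cut) {l : ℕ} {P : Polynomial ℂ} (hP : P.natDegree ≤ l) :
    Polynomial.aeval H.total P =
      ∑ n ∈ exponentBox Q l, (Polynomial.aeval (markedTotal H cut) P).map (MvPolynomial.coeff n) := by
  have h1 : Polynomial.aeval H.total P =
      (MvPolynomial.aeval fun _ : Q => (1 : ℂ)).mapMatrix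
        (Polynomial.aeval (markedTotal H cut) P) := by
    rw [← Polynomial.aeval_algHom_apply]
    congr 2
    exact (map_eval_markedTotal H cut).symm
  rw [h1]
  ext s t
  rw [Matrix.sum_apply]
  exact eval_one_eq_sum_exponentBox
    (totalDegree_aeval_apply_le (totalDegree_markedTotal_le hcut) hP s t)

/-- All terms across cut `q` have weight `X q`, so the letter count is controlled by `n q`. The last
factor counts coefficients of a word, whose entries may still involve the other variables. -/
theorem map_coeff_aeval_mem_productSpan {H : LocalHamiltonian Λ d b h} (hd : 0 < d)
    {cut : Q → Finset Λ} (hcut : DisjointCrossings H cut) {l t c : ℕ} (q : Q)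
    (hc : (H.crossing (cut q)).card * d ^ b ≤ c) {P : Polynomial ℂ} (hP : P.natDegree ≤ l)
    {n : Q →₀ ℕ} (hn : n ∈ exponentBox Q l) (hq : n q ≤ t) :
    ∃ T : Finset (Matrix ({x // x ∈ cut q} → Fin d) ({x // x ∈ cut q} → Fin d) ℂ),
      T.card ≤ (∑ j ∈ Finset.range (t + 1), (l + 1) ^ (j + 1) * c ^ j) *
        (l + 1) ^ Fintype.card Q ∧
      bipartite (cut q) ((Polynomial.aeval (markedTotal H cut) P).map (MvPolynomial.coeff n)) ∈
        productSpan T ({x // x ∉ cut q} → Fin d) := by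
  obtain ⟨K, K', Y, Z, hM⟩ := exists_bipartite_weighted_sum H hd (cutWeight H cut) (cut q)
    (MvPolynomial.X q) fun x hx => cutWeight_eq_X hcut hx
  refine ⟨wordCoeffs K Y l t, (card_wordCoeffs_le K Y l t).trans ?_, ?_⟩
  · gcongr
    simpa using hc
  · have := map_coeff_mem_productSpan hn hq (aeval_mem_wordSpan (MvPolynomial.X q) K K' Y Z P hP)
    rw [← hM] at this
    rw [← markedTotal] at this
    have hP' : Polynomial.aeval (bipartite (cut q) (markedTotal H cut)) P =
        bipartite (cut q) (Polynomial.aeval (markedTotal H cut) P) :=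
      Polynomial.aeval_algHom_apply ((bipartite (cut q)).toAlgHom.restrictScalars ℂ) _ P
    rwa [hP'] at this

/-- A polynomial of the Hamiltonian creates little entanglement across a region that is surrounded
by many cuts. -/
theorem schmidtRank_aeval_total_le {H : LocalHamiltonian Λ d b h} (hd : 0 < d)
    {cut : Q → Finset Λ} (hcut : DisjointCrossings H cut) {l t c δ : ℕ}
    (hlt : l < Fintype.card Q * (t + 1)) (hc : ∀ q, (H.crossing (cut q)).card * d ^ b ≤ c)
    {A : Finset Λ} (hδ : ∀ q, (A \ cut q).card + (cut q \ A).card ≤ δ)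
    {P : Polynomial ℂ} (hP : P.natDegree ≤ l) (ψ : State Λ d) :
    schmidtRank A (Op.act (Polynomial.aeval H.total P) ψ) ≤
      (l + 1) ^ Fintype.card Q * (d ^ δ *
        (((∑ j ∈ Finset.range (t + 1), (l + 1) ^ (j + 1) * c ^ j) * (l + 1) ^ Fintype.card Q) *
          (d ^ δ * schmidtRank A ψ))) := by
  have hact : Op.act (Polynomial.aeval H.total P) ψ = ∑ n ∈ exponentBox Q l,
      Op.act ((Polynomial.aeval (markedTotal H cut) P).map (MvPolynomial.coeff n)) ψ := by
    rw [aeval_total_eq_sum hcut hP]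
    simp only [Op.act, map_sum, sum_apply]
  rw [hact, ← card_exponentBox]
  refine schmidtRank_sum_le _ _ _ _ fun n hn => ?_
  -- Pigeonhole: if every exponent exceeds `t`, the total degree exceeds `l` and the coefficient
  -- vanishes.
  by_cases hq : ∃ q, n q ≤ t
  · obtain ⟨q, hq⟩ := hq
    obtain ⟨T, hT, hmem⟩ := map_coeff_aeval_mem_productSpan hd hcut q (hc q) hP hn hq
    -- The rank is compared at the cut, so the change of region is paid twice: after and before the
    -- operator acts.
    refine (schmidtRank_le_pow_mul A (cut q) _).trans ?_
    have h1 := schmidtRank_act_le hmem ψ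
    have h2 := schmidtRank_le_pow_mul (cut q) A ψ
    rw [card_exponentBox]
    refine Nat.mul_le_mul (Nat.pow_le_pow_right hd (hδ q)) (h1.trans (Nat.mul_le_mul hT
      (h2.trans (Nat.mul_le_mul_right _ (Nat.pow_le_pow_right hd ?_)))))
    rw [add_comm]
    exact hδ q
  · push Not at hq
    have hzero : (Polynomial.aeval (markedTotal H cut) P).map (MvPolynomial.coeff n) = 0 := by
      ext s s'
      rw [Matrix.map_apply, Matrix.zero_apply]
      apply MvPolynomial.coeff_eq_zero_of_totalDegree_lt
      refine (totalDegree_aeval_apply_le (totalDegree_markedTotal_le hcut) hP s s').trans_lt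
        (hlt.trans_le ?_)
      change _ ≤ n.sum fun _ e => e
      rw [Finsupp.sum_fintype _ _ fun _ => rfl, ← Finset.card_univ, ← smul_eq_mul]
      exact Finset.card_nsmul_le_sum _ _ _ fun q _ => hq q
    rw [hzero]
    have : schmidtRank A (Op.act (0 : Op Λ d) ψ) = 0 := by
      have : amplitudes A (Op.act (0 : Op Λ d) ψ) = 0 := by
        ext s u
        simp [amplitudes, Op.act]
      rw [schmidtRank, this, Matrix.rank_zero]
    rw [this]
    exact Nat.zero_le _

end Cuts

/-! ### Spectral consequences of a perfect revival. -/

section Spectral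

variable {Λ : Type*} [Fintype Λ] [DecidableEq Λ] {d : ℕ}

theorem act_mul_apply (M N : Op Λ d) (ψ : State Λ d) : Op.act (M * N) ψ = M.act (N.act ψ) := by
  simp [Op.act]

theorem act_pow_apply_of_eigen {M : Op Λ d} {ψ : State Λ d} {z : ℂ} (h : M.act ψ = z • ψ) (n : ℕ) :
    Op.act (M ^ n) ψ = z ^ n • ψ := by
  induction n with
  | zero => simp [Op.act]
  | succ n ih => rw [pow_succ, act_mul_apply, h, map_smul, ih, smul_smul, pow_succ']

theorem act_aeval_apply_of_eigen {M : Op Λ d} {ψ : State Λ d} {z : ℂ} (h : M.act ψ = z • ψ)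
    (P : Polynomial ℂ) : Op.act (Polynomial.aeval M P) ψ = P.eval z • ψ := by
  rw [Polynomial.aeval_eq_sum_range, Polynomial.eval_eq_sum_range, Finset.sum_smul]
  have : ∀ (s : Finset ℕ) (f : ℕ → Op Λ d), Op.act (∑ i ∈ s, f i) ψ = ∑ i ∈ s, (f i).act ψ := by
    intro s f
    simp [Op.act, sum_apply]
  rw [this]
  refine Finset.sum_congr rfl fun k _ => ?_
  rw [← smul_smul, ← act_pow_apply_of_eigen h]
  simp [Op.act]

theorem act_exp_apply_of_eigen {M : Op Λ d} {ψ : State Λ d} {z : ℂ} (h : M.act ψ = z • ψ) :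
    Op.act (NormedSpace.exp M) ψ = Complex.exp z • ψ := by
  open scoped Matrix.Norms.L2Operator in
  have h1 : HasSum (fun n : ℕ => ((n.factorial : ℂ)⁻¹) • M ^ n) (NormedSpace.exp M) :=
    NormedSpace.exp_series_hasSum_exp' M
  let f : Op Λ d →ₗ[ℂ] State Λ d :=
    { toFun := fun N => N.act ψ
      map_add' := fun N N' => by simp [Op.act]
      map_smul' := fun c N => by simp [Op.act] }
  have h2 := h1.mapL f.toContinuousLinearMap
  have h3 : HasSum (fun n : ℕ => ((n.factorial : ℂ)⁻¹) • z ^ n) (NormedSpace.exp z) :=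
    NormedSpace.exp_series_hasSum_exp' z
  have h4 := h3.smul_const ψ
  rw [← Complex.exp_eq_exp_ℂ] at h4
  refine h2.unique (h4.congr_fun fun n => ?_)
  change Op.act _ ψ = _
  rw [smul_assoc, ← act_pow_apply_of_eigen h]
  simp [Op.act]

theorem timeEvolution_act_apply_of_eigen {M : Op Λ d} {ψ : State Λ d} {ε : ℝ}
    (h : M.act ψ = (ε : ℂ) • ψ) (t : ℝ) :
    (timeEvolution M t).act ψ = Complex.exp (-(Complex.I * t) * ε) • ψ := by
  apply act_exp_apply_of_eigen
  rw [← smul_smul, ← h]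
  simp [Op.act]

theorem norm_total_act_le {b : ℕ} {h : ℝ} (H : LocalHamiltonian Λ d b h) :
    ‖Op.act H.total‖ ≤ h * Fintype.card Λ := by
  have : Op.act H.total = ∑ x, Op.act (H.term x) := by simp [Op.act, LocalHamiltonian.total]
  rw [this]
  refine (norm_sum_le_of_le _ fun x _ => H.norm_le x).trans ?_
  simp [mul_comm]

theorem abs_energy_le {b : ℕ} {h : ℝ} (H : LocalHamiltonian Λ d b h) {ψ : State Λ d}
    (hψ : ‖ψ‖ = 1) {ε : ℝ} (hε : Op.act H.total ψ = (ε : ℂ) • ψ) : |ε| ≤ h * Fintype.card Λ := by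
  have h1 := (Op.act H.total).le_opNorm ψ
  rw [hε, norm_smul, hψ, mul_one, mul_one, Complex.norm_real, Real.norm_eq_abs] at h1
  exact h1.trans (norm_total_act_le H)

variable {ι : Type*} [Fintype ι] {M : Op Λ d} {ψ : State Λ d}
  {e : OrthonormalBasis ι ℂ (State Λ d)} {E : ι → ℝ}

theorem inner_act_of_eigen (N : Op Λ d) (z : ι → ℂ) (hN : ∀ i, N.act (e i) = z i • e i)
    (ψ : State Λ d) (i : ι) : inner ℂ (e i) (N.act ψ) = z i * inner ℂ (e i) ψ := by
  classical
  conv_lhs => rw [← e.sum_repr' ψ]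
  rw [map_sum, inner_sum, Finset.sum_eq_single i]
  · rw [map_smul, hN, inner_smul_right, inner_smul_right, inner_self_eq_norm_sq_to_K,
      e.orthonormal.1 i]
    simp [mul_comm]
  · intro j _ hj
    rw [map_smul, hN, inner_smul_right, inner_smul_right, e.orthonormal.2 hj.symm]
    simp
  · simp

/-- At a perfect revival all the energies that occur in the state have the same phase. -/
theorem exists_phase_of_fidelity_eq (he : ∀ i, M.act (e i) = (E i : ℂ) • e i) (hψ : ‖ψ‖ = 1)
    {t : ℝ} (ht : fidelity M ψ t = fidelity M ψ 0) :
    ∃ θ : ℂ, ∀ i, inner ℂ (e i) ψ ≠ 0 → Complex.exp (-(Complex.I * t) * E i) = θ := by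
  have hU : ∀ i, (timeEvolution M t).act (e i) = Complex.exp (-(Complex.I * t) * E i) • e i :=
    fun i => timeEvolution_act_apply_of_eigen (he i) t
  have hinner := inner_act_of_eigen _ _ hU ψ
  have hnorm : ‖(timeEvolution M t).act ψ‖ = 1 := by
    have h1 : ‖(timeEvolution M t).act ψ‖ ^ 2 = ‖ψ‖ ^ 2 := by
      rw [← e.sum_sq_norm_inner_right, ← e.sum_sq_norm_inner_right]
      refine Finset.sum_congr rfl fun i _ => ?_
      rw [hinner, norm_mul, Complex.norm_exp]
      simp
    rw [hψ] at h1
    nlinarith [norm_nonneg ((timeEvolution M t).act ψ)]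
  have h0 : fidelity M ψ 0 = 1 := by
    have : timeEvolution M 0 = 1 := by simp [timeEvolution]
    rw [fidelity, this, expect]
    simp [Op.act, hψ]
  rw [h0, fidelity, expect] at ht
  have hψ0 : ψ ≠ 0 := fun h => by simp [h] at hψ
  have hUψ0 : (timeEvolution M t).act ψ ≠ 0 := fun h => by simp [h] at hnorm
  -- Equality in Cauchy–Schwarz makes the evolved state a multiple of `ψ`.
  obtain ⟨θ, -, hθ⟩ := (norm_inner_eq_norm_iff (𝕜 := ℂ) hψ0 hUψ0).mp (by rw [ht, hψ, hnorm, mul_one])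
  refine ⟨θ, fun i hi => ?_⟩
  have := hinner i
  rw [hθ, inner_smul_right] at this
  exact (mul_right_cancel₀ hi this).symm

/-- A set of real numbers in `[-r, r]` that differ by multiples of `2π / t` has at most
`r t / π + 1` elements. -/
theorem card_sub_one_le_of_phase {J : Finset ι} (hJ : J.Nonempty) {t r : ℝ} (ht : 0 < t)
    (hr : ∀ i ∈ J, |E i| ≤ r) (hinj : ∀ i ∈ J, ∀ j ∈ J, E i = E j → i = j) {θ : ℂ}
    (hθ : ∀ i ∈ J, Complex.exp (-(Complex.I * t) * E i) = θ) :
    ((J.card - 1 : ℕ) : ℝ) ≤ r * t / Real.pi := by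
  classical
  obtain ⟨i₀, hi₀, hmin⟩ := J.exists_min_image E hJ
  have hn : ∀ i ∈ J, ∃ n : ℤ, (E i - E i₀) * t = n * (2 * Real.pi) := by
    intro i hi
    obtain ⟨n, hn⟩ := Complex.exp_eq_exp_iff_exists_int.mp ((hθ i₀ hi₀).trans (hθ i hi).symm)
    refine ⟨n, ?_⟩
    have h2 : Complex.I * (((E i - E i₀) * t : ℝ) : ℂ) = Complex.I * ((n * (2 * Real.pi) : ℝ) : ℂ) := by
      push_cast
      linear_combination hn
    exact_mod_cast mul_left_cancel₀ Complex.I_ne_zero h2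
  choose! n hn using hn
  have hpi := Real.pi_pos
  -- Measured from the lowest energy, a range of width `2 r` is cut into steps of `2π / t`.
  have hmaps : ∀ i ∈ J, n i ∈ Finset.Icc (0 : ℤ) ⌊r * t / Real.pi⌋ := by
    intro i hi
    rw [Finset.mem_Icc, Int.le_floor, le_div_iff₀ hpi]
    constructor
    · have h1 : 0 ≤ (n i : ℝ) * (2 * Real.pi) := by
        rw [← hn i hi]
        exact mul_nonneg (sub_nonneg.mpr (hmin i hi)) ht.le
      exact_mod_cast nonneg_of_mul_nonneg_left h1 (by positivity)
    · have h1 := abs_le.mp (hr i hi)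
      have h2 := abs_le.mp (hr i₀ hi₀)
      have h3 : (E i - E i₀) * t ≤ (2 * r) * t := mul_le_mul_of_nonneg_right (by linarith) ht.le
      rw [hn i hi] at h3
      linarith
  have hinj' : Set.InjOn n J := by
    intro i hi j hj hij
    apply hinj i hi j hj
    have : (E i - E i₀) * t = (E j - E i₀) * t := by rw [hn i hi, hn j hj, hij]
    linarith [mul_right_cancel₀ ht.ne' this]
  have hcard := Finset.card_le_card_of_injOn n hmaps hinj'
  have hnn : 0 ≤ r * t / Real.pi := by
    have := (abs_nonneg _).trans (hr i₀ hi₀)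
    positivity
  rw [Int.card_Icc, sub_zero] at hcard
  have h5 : J.card - 1 ≤ ⌊r * t / Real.pi⌋.toNat := by
    have := Int.floor_nonneg.mpr hnn
    omega
  calc ((J.card - 1 : ℕ) : ℝ) ≤ (⌊r * t / Real.pi⌋.toNat : ℝ) := by exact_mod_cast h5
    _ = ((⌊r * t / Real.pi⌋.toNat : ℤ) : ℝ) := by push_cast; rfl
    _ = (⌊r * t / Real.pi⌋ : ℝ) := by rw [Int.toNat_of_nonneg (Int.floor_nonneg.mpr hnn)]
    _ ≤ _ := Int.floor_le _

theorem energyStdDev_of_eigen {ε : ℝ} (h : M.act ψ = (ε : ℂ) • ψ) (hψ : ‖ψ‖ = 1) :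
    energyStdDev M ψ = 0 := by
  have h1 : inner ℂ ψ ψ = (1 : ℂ) := by rw [inner_self_eq_norm_sq_to_K, hψ]; simp
  rw [energyStdDev, expect, expect, act_mul_apply, h, map_smul, h, inner_smul_right,
    inner_smul_right, h1]
  simp [sq]

end Spectral

/-! ### Eigenvectors as polynomials of `H`, and the growth of entropy. -/

section Revival

variable {Λ : Type*} [Fintype Λ] [DecidableEq Λ] {d : ℕ}

section Eigenbasis

variable {ι : Type*} [Fintype ι] {M : Op Λ d} {ψ : State Λ d}
  {e : OrthonormalBasis ι ℂ (State Λ d)} {E : ι → ℝ}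

/-- The labels of the eigenvectors that occur in the state. -/
def occupied (e : OrthonormalBasis ι ℂ (State Λ d)) (ψ : State Λ d) : Finset ι := by
  classical
  exact Finset.univ.filter fun i => inner ℂ (e i) ψ ≠ 0

theorem mem_occupied {i : ι} : i ∈ occupied e ψ ↔ inner ℂ (e i) ψ ≠ 0 := by
  simp [occupied]

/-- An occupied eigenvector is obtained from the state by a polynomial of the Hamiltonian. -/
theorem exists_polynomial_act_eq_smul (he : IsAdaptedEigenbasis M ψ e E) {i : ι}
    (hi : inner ℂ (e i) ψ ≠ 0) :
    ∃ P : Polynomial ℂ, P.natDegree ≤ (occupied e ψ).card - 1 ∧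
      ∃ κ : ℂ, κ ≠ 0 ∧ Op.act (Polynomial.aeval M P) ψ = κ • e i := by
  classical
  -- The unnormalised Lagrange polynomial, vanishing at every occupied energy except `E i`.
  let P : Polynomial ℂ :=
    ∏ j ∈ (occupied e ψ).erase i, (Polynomial.X - Polynomial.C (E j : ℂ))
  have heval : ∀ z : ℂ, P.eval z = ∏ j ∈ (occupied e ψ).erase i, (z - E j) := fun z => by
    simp [P, Polynomial.eval_prod]
  refine ⟨P, ?_, P.eval (E i : ℂ) * inner ℂ (e i) ψ, mul_ne_zero ?_ hi, ?_⟩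
  · rw [Polynomial.natDegree_prod_of_monic _ _ fun j _ => Polynomial.monic_X_sub_C _]
    simp [Finset.card_erase_of_mem (mem_occupied.mpr hi)]
  · rw [heval, Finset.prod_ne_zero_iff]
    intro j hj
    rw [Finset.mem_erase] at hj
    rw [sub_ne_zero]
    intro hij
    exact hj.1 (he.unique i j hi (mem_occupied.mp hj.2) (by exact_mod_cast hij)).symm
  · have hinner := inner_act_of_eigen (Polynomial.aeval M P) (fun j => P.eval (E j : ℂ))
      (fun j => act_aeval_apply_of_eigen (he.eigen j) P) ψ
    rw [← e.sum_repr' (Op.act (Polynomial.aeval M P) ψ), Finset.sum_eq_single i]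
    · rw [hinner]
    · intro j _ hj
      rw [hinner]
      by_cases hc : inner ℂ (e j) ψ = 0
      · rw [hc, mul_zero, zero_smul]
      · rw [heval, Finset.prod_eq_zero (Finset.mem_erase.mpr ⟨hj, mem_occupied.mpr hc⟩)
          (sub_self _), zero_mul, zero_smul]
    · simp

/-- A state with a single occupied vector is an eigenvector and has no energy spread. This secures
degree `l ≥ 1`, which the numerical estimates need. -/
theorem two_le_card_occupied (he : IsAdaptedEigenbasis M ψ e E) (hψ : ‖ψ‖ = 1)
    (hσ : 0 < energyStdDev M ψ) {i : ι} (hi : inner ℂ (e i) ψ ≠ 0) :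
    2 ≤ (occupied e ψ).card := by
  classical
  by_contra hlt
  have hcard : (occupied e ψ).card ≤ 1 := by omega
  have hψi : ψ = inner ℂ (e i) ψ • e i := by
    conv_lhs => rw [← e.sum_repr' ψ]
    refine Finset.sum_eq_single i (fun j _ hj => ?_) (by simp)
    by_contra hne
    have hcj : inner ℂ (e j) ψ ≠ 0 := fun h0 => hne (by rw [h0, zero_smul])
    exact hj (Finset.card_le_one.mp hcard j (mem_occupied.mpr hcj) i (mem_occupied.mpr hi))
  have heig : M.act ψ = (E i : ℂ) • ψ := by
    rw [hψi, map_smul, he.eigen, smul_comm]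
  exact hσ.ne' (energyStdDev_of_eigen heig hψ)

/-- The number of occupied eigenvectors at a perfect revival. -/
theorem card_occupied_sub_one_le {b : ℕ} {h : ℝ} {H : LocalHamiltonian Λ d b h}
    (he : IsAdaptedEigenbasis H.total ψ e E) (hψ : ‖ψ‖ = 1) {t : ℝ} (ht : 0 < t)
    (hrev : fidelity H.total ψ t = fidelity H.total ψ 0) {i : ι} (hi : inner ℂ (e i) ψ ≠ 0) :
    (((occupied e ψ).card - 1 : ℕ) : ℝ) ≤ h * Fintype.card Λ * t / Real.pi := by
  obtain ⟨θ, hθ⟩ := exists_phase_of_fidelity_eq he.eigen hψ hrev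
  exact card_sub_one_le_of_phase ⟨i, mem_occupied.mpr hi⟩ ht
    (fun j _ => abs_energy_le H (e.orthonormal.1 j) (he.eigen j))
    (fun j hj k hk => he.unique j k (mem_occupied.mp hj) (mem_occupied.mp hk))
    fun j hj => hθ j (mem_occupied.mp hj)

end Eigenbasis

/-- A crossing term needs a site on each side. The case is separate because `many_cuts_estimate`
needs `b ≥ 2`. -/
theorem crossing_eq_empty {b : ℕ} {h : ℝ} (H : LocalHamiltonian Λ d b h) (hb : b ≤ 1)
    (A : Finset Λ) : H.crossing A = ∅ := by
  refine Finset.filter_false_of_mem fun x _ hx => ?_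
  have := Finset.card_inter_add_card_sdiff (H.supp x) A
  have := H.card_supp_le x
  have := hx.1.card_pos
  have := hx.2.card_pos
  omega

/-- The cuts of a regular bipartition. -/
theorem LocalHamiltonian.IsRegular.exists_cuts {b : ℕ} {h : ℝ} {H : LocalHamiltonian Λ d b h}
    {G : SimpleGraph Λ} [DecidableRel G.Adj] {m : ℕ} {A : Finset Λ} (hreg : H.IsRegular G m A) :
    ∃ cut : Finset.Icc (-(m : ℤ)) m → Finset Λ, DisjointCrossings H cut ∧
      ∀ q, (A \ cut q).card + (cut q \ A).card ≤ 10 * m * boundaryArea G A := by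
  obtain ⟨R, h0, -, hmono, houter, hinner, hdisj⟩ := hreg
  have hchain : ∀ k : ℕ, ∀ q : ℤ, -(m : ℤ) ≤ q → q + k ≤ m → R q ⊆ R (q + k) := by
    intro k
    induction k with
    | zero => intro q _ _; simp
    | succ k ih =>
      intro q hq hqk
      push_cast at hqk ⊢
      rw [← add_assoc]
      exact (ih q hq (by omega)).trans (hmono _ ⟨by omega, by omega⟩)
  have hle : ∀ q q' : ℤ, -(m : ℤ) ≤ q → q ≤ q' → q' ≤ m → R q ⊆ R q' := by
    intro q q' h1 h2 h3
    obtain ⟨k, rfl⟩ := Int.le.dest h2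
    exact hchain k q h1 h3
  refine ⟨fun q => R q, fun x q q' hx hx' => ?_, fun q => ?_⟩
  · exact Subtype.ext (hdisj x q (Finset.mem_Icc.mp q.2) q' (Finset.mem_Icc.mp q'.2) hx hx')
  · obtain ⟨hq1, hq2⟩ := Finset.mem_Icc.mp q.2
    -- Cuts of nonnegative index contain `A` and the others lie inside it, so one of the two
    -- differences is always empty.
    rcases le_total 0 q.1 with hq | hq
    · have h1 : A ⊆ R q := h0 ▸ hle 0 q (by omega) hq hq2
      rw [Finset.sdiff_eq_empty_iff_subset.mpr h1, Finset.card_empty, zero_add]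
      exact (Finset.card_le_card (Finset.sdiff_subset_sdiff (hle q m hq1 hq2 le_rfl)
        (Finset.Subset.refl A))).trans houter
    · have h1 : R q ⊆ A := h0 ▸ hle q 0 hq1 hq (by omega)
      rw [Finset.sdiff_eq_empty_iff_subset.mpr h1, Finset.card_empty, add_zero]
      exact (Finset.card_le_card (Finset.sdiff_subset_sdiff (Finset.Subset.refl A)
        (hle (-m) q le_rfl hq1 hq2))).trans hinner

theorem sum_word_counts_le {l t c : ℕ} (htl : t ≤ l) (hc : 1 ≤ c) :
    ∑ j ∈ Finset.range (t + 1), (l + 1) ^ (j + 1) * c ^ j ≤ (l + 1) ^ (t + 2) * c ^ t := by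
  calc ∑ j ∈ Finset.range (t + 1), (l + 1) ^ (j + 1) * c ^ j
      ≤ ∑ j ∈ Finset.range (t + 1), (l + 1) ^ (t + 1) * c ^ t := by
        refine Finset.sum_le_sum fun j hj => ?_
        have hjt : j ≤ t := by rw [Finset.mem_range] at hj; omega
        exact Nat.mul_le_mul (Nat.pow_le_pow_right (Nat.succ_pos l) (by omega))
          (Nat.pow_le_pow_right hc hjt)
    _ = (t + 1) * ((l + 1) ^ (t + 1) * c ^ t) := by simp
    _ ≤ (l + 1) * ((l + 1) ^ (t + 1) * c ^ t) := by gcongr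
    _ = _ := by ring

/-- The growth of the entropy of a state under a polynomial of the Hamiltonian. -/
theorem log_schmidtRank_aeval_total_le {b : ℕ} {h : ℝ} {H : LocalHamiltonian Λ d b h}
    {Q : Type*} [Fintype Q] [DecidableEq Q] (hd : 0 < d) (hN : 0 < Fintype.card Λ)
    {cut : Q → Finset Λ} (hcut : DisjointCrossings H cut) {l t δ : ℕ} (htl : t ≤ l)
    (hlt : l < Fintype.card Q * (t + 1)) {A : Finset Λ}
    (hδ : ∀ q, (A \ cut q).card + (cut q \ A).card ≤ δ) {P : Polynomial ℂ} (hP : P.natDegree ≤ l)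
    {ψ : State Λ d} (hne : Op.act (Polynomial.aeval H.total P) ψ ≠ 0) :
    Real.log (schmidtRank A (Op.act (Polynomial.aeval H.total P) ψ)) ≤
      (2 * Fintype.card Q + t + 2) * Real.log (l + 1) +
        t * (Real.log (Fintype.card Λ) + b * Real.log d) + 2 * δ * Real.log d +
        Real.log (schmidtRank A ψ) := by
  have hψ : ψ ≠ 0 := fun h0 => hne (by rw [h0, map_zero])
  -- Counting all terms as crossing is affordable, since the count enters only through a logarithm.
  have hc : ∀ q, (H.crossing (cut q)).card * d ^ b ≤ Fintype.card Λ * d ^ b := fun q =>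
    Nat.mul_le_mul_right _ (Finset.card_le_univ _)
  have h1 := schmidtRank_aeval_total_le hd hcut hlt hc hδ hP ψ
  have hc1 : 1 ≤ Fintype.card Λ * d ^ b := Nat.mul_pos hN (pow_pos hd b)
  have h2 : schmidtRank A (Op.act (Polynomial.aeval H.total P) ψ) ≤
      (l + 1) ^ (2 * Fintype.card Q + t + 2) * (Fintype.card Λ * d ^ b) ^ t * d ^ (2 * δ) *
        schmidtRank A ψ := by
    refine h1.trans ?_
    calc _ ≤ (l + 1) ^ Fintype.card Q * (d ^ δ *
          ((((l + 1) ^ (t + 2) * (Fintype.card Λ * d ^ b) ^ t) * (l + 1) ^ Fintype.card Q) *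
          (d ^ δ * schmidtRank A ψ))) := by
            gcongr
            exact sum_word_counts_le htl hc1
      _ = _ := by ring
  have hpos := schmidtRank_pos A hne
  have hpos' := schmidtRank_pos A hψ
  have h3 : (schmidtRank A (Op.act (Polynomial.aeval H.total P) ψ) : ℝ) ≤
      ((l : ℝ) + 1) ^ (2 * Fintype.card Q + t + 2) * ((Fintype.card Λ : ℝ) * (d : ℝ) ^ b) ^ t *
        (d : ℝ) ^ (2 * δ) * schmidtRank A ψ := by exact_mod_cast h2
  have hd' : (d : ℝ) ≠ 0 := by exact_mod_cast hd.ne'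
  have hN' : (Fintype.card Λ : ℝ) ≠ 0 := by exact_mod_cast hN.ne'
  have hl' : (l : ℝ) + 1 ≠ 0 := by positivity
  have hr' : (schmidtRank A ψ : ℝ) ≠ 0 := by exact_mod_cast hpos'.ne'
  refine (Real.log_le_log (by exact_mod_cast hpos) h3).trans (le_of_eq ?_)
  rw [Real.log_mul (by positivity) hr', Real.log_mul (by positivity) (by positivity),
    Real.log_mul (by positivity) (by positivity), Real.log_pow, Real.log_pow, Real.log_pow,
    Real.log_mul hN' (by positivity), Real.log_pow]
  push_cast
  ring

/-- Without terms across the boundary, the entropy grows only logarithmically with the degree. -/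
theorem log_schmidtRank_aeval_total_le_of_crossing_eq_empty {b : ℕ} {h : ℝ}
    {H : LocalHamiltonian Λ d b h} (hd : 0 < d) {l : ℕ} {A : Finset Λ} (hA : H.crossing A = ∅)
    {P : Polynomial ℂ} (hP : P.natDegree ≤ l)
    {ψ : State Λ d} (hne : Op.act (Polynomial.aeval H.total P) ψ ≠ 0) :
    Real.log (schmidtRank A (Op.act (Polynomial.aeval H.total P) ψ)) ≤
      3 * Real.log (l + 1) + Real.log (schmidtRank A ψ) := by
  have hψ : ψ ≠ 0 := fun h0 => hne (by rw [h0, map_zero])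
  -- The only cut is `A` itself. With `c = 0` only the word without letters is counted, through `0 ^
  -- 0 = 1`.
  have h1 := schmidtRank_aeval_total_le (H := H) (Q := Unit) (cut := fun _ => A) (t := l) (c := 0) (δ := 0)
    hd (fun _ _ _ _ _ => rfl) (by simp) (fun _ => by simp [hA]) (A := A) (by simp) hP ψ
  have hsum : ∑ j ∈ Finset.range (l + 1), (l + 1) ^ (j + 1) * 0 ^ j = l + 1 := by
    rw [Finset.sum_eq_single 0] <;> simp
  have h2 : schmidtRank A (Op.act (Polynomial.aeval H.total P) ψ) ≤
      (l + 1) ^ 3 * schmidtRank A ψ := by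
    refine h1.trans (le_of_eq ?_)
    rw [hsum, Fintype.card_unit]
    ring
  have hpos := schmidtRank_pos A hne
  have hpos' := schmidtRank_pos A hψ
  have h3 : (schmidtRank A (Op.act (Polynomial.aeval H.total P) ψ) : ℝ) ≤
      ((l : ℝ) + 1) ^ 3 * schmidtRank A ψ := by exact_mod_cast h2
  refine (Real.log_le_log (by exact_mod_cast hpos) h3).trans (le_of_eq ?_)
  rw [Real.log_mul (by positivity) (by exact_mod_cast hpos'.ne'), Real.log_pow]
  push_cast
  rfl

end Revival

/-! ### Numerical estimates. -/

section Estimates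

variable {x a l ν : ℝ}

theorem log_add_one_le_log (hl : 1 ≤ l) (hlx : l ≤ x / Real.pi) :
    Real.log (l + 1) ≤ Real.log x := by
  apply Real.log_le_log (by linarith)
  have := (le_div_iff₀ Real.pi_pos).mp hlx
  nlinarith [Real.pi_gt_three]

/-- The estimate for a single cut, used when there are few energies. -/
theorem single_cut_estimate (hl : 1 ≤ l) (hlx : l ≤ x / Real.pi) (ha : 1 ≤ a)
    (hr : Real.sqrt (x / (Real.pi * a)) ≤ 7) (hν : 0 ≤ ν) :
    (l + 4) * Real.log (l + 1) + l * ν ≤ 7 * Real.sqrt (x * a) * (Real.log x + ν) := by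
  have hlog := log_add_one_le_log hl hlx
  have hlog0 : 0 ≤ Real.log (l + 1) := Real.log_nonneg (by linarith)
  have hpi := Real.pi_gt_d2
  have hlx' : l * Real.pi ≤ x := (le_div_iff₀ Real.pi_pos).mp hlx
  have hx : 3.14 ≤ x := by nlinarith
  have hxa : x ≤ 49 * (Real.pi * a) := by
    rw [Real.sqrt_le_left (by norm_num), div_le_iff₀ (by positivity)] at hr
    linarith
  -- The constant 7 splits as `3 + 4`: three for the additive 4, four for `l`, where `49 / 3.14 <
  -- 16`.
  have h4 : 4 ≤ 3 * Real.sqrt (x * a) := by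
    have : 4 / 3 ≤ Real.sqrt (x * a) := Real.le_sqrt_of_sq_le (by nlinarith)
    linarith
  have hly : l ≤ 4 * Real.sqrt (x * a) := by
    have : l / 4 ≤ Real.sqrt (x * a) := by
      refine Real.le_sqrt_of_sq_le ?_
      have h1 : (l * Real.pi) * (l * Real.pi) ≤ x * (49 * (Real.pi * a)) :=
        mul_le_mul hlx' (hlx'.trans hxa) (by positivity) (by linarith)
      have h2 : l * l * Real.pi ≤ 49 * (x * a) := by
        refine le_of_mul_le_mul_right ?_ Real.pi_pos
        linarith
      have h3 : l * l * 3.14 ≤ l * l * Real.pi := by gcongr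
      nlinarith
    linarith
  calc (l + 4) * Real.log (l + 1) + l * ν
      ≤ (7 * Real.sqrt (x * a)) * Real.log x + (7 * Real.sqrt (x * a)) * ν := by
        gcongr <;> linarith
    _ = _ := by ring

/-- The estimate for `2 m + 1` cuts. -/
theorem many_cuts_estimate {m t β η : ℝ} (hl : 1 ≤ l) (hlx : l ≤ x / Real.pi) (ha : 1 ≤ a)
    (hr : 7 ≤ Real.sqrt (x / (Real.pi * a))) (hm : |m - Real.sqrt (x / (Real.pi * a))| < 1)
    (ht0 : 0 ≤ t) (ht : t * (2 * m + 1) ≤ l) (hβ : 2 ≤ β) (hν : 0 ≤ ν) (hη : 0 ≤ η) :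
    (2 * (2 * m + 1) + t + 2) * Real.log (l + 1) + t * (ν + β * η) + 2 * (10 * m * a) * η ≤
      7 * Real.sqrt (x * a) * (Real.log x + (ν + β * η)) := by
  have hlog := log_add_one_le_log hl hlx
  have hlog0 : 0 ≤ Real.log (l + 1) := Real.log_nonneg (by linarith)
  have hpi := Real.pi_gt_d2
  have hlx' : l * Real.pi ≤ x := (le_div_iff₀ Real.pi_pos).mp hlx
  have hx : 0 ≤ x := by nlinarith
  have hsq := Real.sq_sqrt (show 0 ≤ x / (Real.pi * a) by positivity)
  set r := Real.sqrt (x / (Real.pi * a)) with hrdef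
  have hxr : x = Real.pi * a * r ^ 2 := by
    rw [hsq]
    field_simp
  obtain ⟨hm1, hm2⟩ := abs_lt.mp hm
  have hra : r ≤ r * a := by nlinarith
  have hlr : l ≤ a * r ^ 2 := by
    refine hlx.trans (le_of_eq ?_)
    rw [hxr]
    field_simp
  -- Here `√(x a) = √π r a`, and `1.77 ^ 2 < 3.14`.
  have hy : 1.77 * (r * a) ≤ Real.sqrt (x * a) := by
    refine Real.le_sqrt_of_sq_le ?_
    rw [hxr]
    have : 0 ≤ (r * a) ^ 2 := sq_nonneg _
    nlinarith
  -- Since `r ≥ 7`, `2 m + 1 > 2 r - 1 ≥ 13 r / 7`; likewise `m < r + 1 ≤ 8 r / 7` below.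
  have htr : t ≤ 7 / 13 * (r * a) := by
    have h1 : t * (13 / 7 * r) ≤ a * r ^ 2 :=
      (mul_le_mul_of_nonneg_left (by linarith) ht0).trans (ht.trans hlr)
    have h2 : t * r ≤ 7 / 13 * (r * a) * r := by linarith
    exact le_of_mul_le_mul_right h2 (by linarith)
  have hma : m * a ≤ 8 / 7 * (r * a) := by
    have : m ≤ 8 / 7 * r := by linarith
    calc m * a ≤ 8 / 7 * r * a := by gcongr
      _ = _ := by ring
  have hra0 : 0 ≤ r * a := by positivity
  have h1 : (2 * (2 * m + 1) + t + 2) * Real.log (l + 1) ≤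
      (7 * Real.sqrt (x * a)) * Real.log x := by
    gcongr
    linarith
  have h2 : t * ν ≤ (7 * Real.sqrt (x * a)) * ν := by
    gcongr
    linarith
  -- The cost of moving sites is absorbed using `β ≥ 2`; it fits because `7 / 13 + 80 / 7 < 7 *
  -- 1.77`.
  have h3 : (t * β + 20 * (m * a)) * η ≤ (7 * Real.sqrt (x * a) * β) * η := by
    gcongr
    have h4 : t * β ≤ 7 / 13 * (r * a) * β := by gcongr
    have h5 : 20 * (m * a) ≤ 80 / 7 * (r * a) * β := by nlinarith
    have h6 : 1.77 * (r * a) * β ≤ Real.sqrt (x * a) * β := by gcongr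
    have h7 : 0 ≤ (r * a) * β := by positivity
    linarith
  linarith

end Estimates

end SpinLattice

end

/-! ### The entropy bound. -/

open SpinLattice

theorem theorem3 {Λ : Type*} [Fintype Λ] [DecidableEq Λ]
    (G : SimpleGraph Λ) [DecidableRel G.Adj] {d b : ℕ} {h : ℝ}
    (H : SpinLattice.LocalHamiltonian Λ d b h)
    (Ψ : SpinLattice.State Λ d) (hΨ : ‖Ψ‖ = 1)
    (χ : ℝ) (hχ : 0 < χ) (hlow : SpinLattice.IsLowEntangled G χ Ψ)
    (hσ : 0 < SpinLattice.energyStdDev H.total Ψ)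
    (τ : ℝ) (hτ : 0 < τ)
    (hrev : SpinLattice.fidelity H.total Ψ τ = SpinLattice.fidelity H.total Ψ 0)
    {ι : Type*} [Fintype ι]
    (e : OrthonormalBasis ι ℂ (SpinLattice.State Λ d)) (E : ι → ℝ)
    (he : SpinLattice.IsAdaptedEigenbasis H.total Ψ e E)
    (A : Finset Λ) (hA : 0 < SpinLattice.boundaryArea G A)
    (m : ℕ) (hm : 0 < m)
    (hmA : |(m : ℝ) - Real.sqrt (h * (Fintype.card Λ : ℝ) * τ /
      (Real.pi * (SpinLattice.boundaryArea G A : ℝ)))| < 1)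
    (hreg : H.IsRegular G m A)
    (i : ι) (hi : inner ℂ (e i) Ψ ≠ 0) :
    SpinLattice.renyiZero (SpinLattice.reducedDensity A (e i)) ≤
      7 * Real.sqrt (h * (Fintype.card Λ : ℝ) * τ * (SpinLattice.boundaryArea G A : ℝ)) *
          Real.log (h * (Fintype.card Λ : ℝ) ^ 2 * τ * (d : ℝ) ^ b) +
        (SpinLattice.boundaryArea G A : ℝ) * Real.log χ := by
  classical
  have hΨ0 : Ψ ≠ 0 := fun h0 => by simp [h0] at hΨ
  obtain ⟨y, -⟩ : ∃ y, y ∈ A := by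
    by_contra hemp
    push Not at hemp
    rw [boundaryArea, Finset.eq_empty_of_forall_notMem hemp, SimpleGraph.interedges_def] at hA
    simp at hA
  have hN : 0 < Fintype.card Λ := Fintype.card_pos_iff.mpr ⟨y⟩
  have hd : 0 < d := by
    rw [Nat.pos_iff_ne_zero]
    rintro rfl
    exact hΨ0 (by ext s; exact (s y).elim0)
  obtain ⟨P, hP, κ, hκ, hact⟩ := exists_polynomial_act_eq_smul he hi
  have hJ := two_le_card_occupied he hΨ hσ hi
  have hlx := card_occupied_sub_one_le he hΨ hτ hrev hi
  set l := (occupied e Ψ).card - 1 with hl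
  have hl1 : 1 ≤ l := by omega
  have hl1' : (1 : ℝ) ≤ l := by exact_mod_cast hl1
  set a := boundaryArea G A with ha
  have ha1 : (1 : ℝ) ≤ a := by exact_mod_cast hA
  set x := h * (Fintype.card Λ : ℝ) * τ with hx
  have hxpi : Real.pi ≤ x := (one_le_div₀ Real.pi_pos).mp (hl1'.trans hlx)
  have hx1 : 1 ≤ x := by linarith [Real.pi_gt_three]
  have hei : e i ≠ 0 := e.orthonormal.ne_zero i
  have hne : Op.act (Polynomial.aeval H.total P) Ψ ≠ 0 := by
    rw [hact]
    exact smul_ne_zero hκ hei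
  have hrenyi : renyiZero (reducedDensity A (e i)) =
      Real.log (schmidtRank A (Op.act (Polynomial.aeval H.total P) Ψ)) := by
    rw [renyiZero, rank_reducedDensity, hact, schmidtRank_smul A hκ]
  have hχa : Real.log (schmidtRank A Ψ) ≤ a * Real.log χ := by
    rw [← Real.log_pow, ← rank_reducedDensity]
    refine Real.log_le_log ?_ (hlow A)
    rw [rank_reducedDensity]
    exact_mod_cast schmidtRank_pos A hΨ0
  have hd' : (0 : ℝ) < d := by exact_mod_cast hd
  have hN' : (0 : ℝ) < Fintype.card Λ := by exact_mod_cast hN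
  have hlogx : 0 ≤ Real.log x := Real.log_nonneg hx1
  have hlogN : 0 ≤ Real.log (Fintype.card Λ) := Real.log_nonneg (by exact_mod_cast hN)
  have hlogd : 0 ≤ Real.log d := Real.log_nonneg (by exact_mod_cast hd)
  have hlog : Real.log (h * (Fintype.card Λ : ℝ) ^ 2 * τ * (d : ℝ) ^ b) =
      Real.log x + (Real.log (Fintype.card Λ) + b * Real.log d) := by
    rw [← Real.log_pow, ← Real.log_mul hN'.ne' (by positivity),
      ← Real.log_mul (by linarith) (by positivity), hx]
    ring_nf
  rw [hrenyi, hlog]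
  rcases Nat.lt_or_ge b 2 with hb | hb
  · have h1 := log_schmidtRank_aeval_total_le_of_crossing_eq_empty hd
      (crossing_eq_empty H (by omega) A) hP hne
    have h2 := log_add_one_le_log hl1' hlx
    have h3 : 1 ≤ Real.sqrt (x * a) := by
      rw [Real.one_le_sqrt]
      nlinarith
    have hb0 : (0 : ℝ) ≤ b * Real.log d := by positivity
    nlinarith
  -- For a small ratio the rounding of `m` is too coarse for `many_cuts_estimate`; `A` alone then
  -- serves as the cut, with `t = l` and no sites moved.
  · rcases le_total (Real.sqrt (x / (Real.pi * a))) 7 with hr | hr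
    · have h1 := log_schmidtRank_aeval_total_le (Q := Unit) (cut := fun _ => A) (t := l) (δ := 0)
        hd hN (fun _ _ _ _ _ => rfl) le_rfl (by simp) (A := A) (by simp) hP hne
      have h2 := single_cut_estimate hl1' hlx ha1 hr
        (ν := Real.log (Fintype.card Λ) + b * Real.log d) (by positivity)
      rw [Fintype.card_unit] at h1
      push_cast at h1
      linarith
    · obtain ⟨cut, hcut, hδ⟩ := hreg.exists_cuts
      have hcard : Fintype.card (Finset.Icc (-(m : ℤ)) m) = 2 * m + 1 := by
        rw [Fintype.card_coe, Int.card_Icc]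
        omega
      -- The floor gives both `l < (2 m + 1) (t + 1)` for the pigeonhole and `t (2 m + 1) ≤ l` for
      -- the estimate.
      have h1 := log_schmidtRank_aeval_total_le (t := l / (2 * m + 1)) hd hN hcut
        (Nat.div_le_self _ _) (by rw [hcard]; exact Nat.lt_mul_div_succ _ (by omega)) hδ hP hne
      have ht : ((l / (2 * m + 1) : ℕ) : ℝ) * (2 * m + 1) ≤ l := by
        exact_mod_cast Nat.div_mul_le_self l (2 * m + 1)
      have h2 := many_cuts_estimate hl1' hlx ha1 hr hmA (Nat.cast_nonneg _) ht
        (by exact_mod_cast hb : (2 : ℝ) ≤ b) hlogN hlogd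
      rw [hcard] at h1
      push_cast at h1 h2
      linarith
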